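/- Let $(H,G,t,\Phi)$ be a crossed module of (real, smooth) Lie groups: $t:H\to G$ is a smooth homomorphism and $\Phi:G\to\mathrm{Aut}(H)$ is a smooth action by automorphisms with $\Phi(t(p))q=pqp^{-1}$ and $t(\Phi(a)p)=a\,t(p)\,a^{-1}$ for all $p,q\in H$, $a\in G$. Let $(\mathcal B_1,\mathcal B_0)$ be a Rota--Baxter operator on it, i.e. $\mathcal B_1:H\to H$ and $\mathcal B_0:G\to G$ are smooth maps such that $\mathcal B_i(a)\mathcal B_i(b)=\mathcal B_i\big(a\,\mathcal B_i(a)\,b\,\mathcal B_i(a)^{-1}\big)$ for $i=0,1$, $t\circ\mathcal B_1=\mathcal B_0\circ t$, and, with $$\hat\Phi(a)p=\Phi(a\mathcal B_0(a))(p\,\mathcal B_1(p))\cdot\Phi(\mathcal B_0(a))\big(\mathcal B_1(p)^{-1}\big),$$ $\Phi(\mathcal B_0(a))\mathcal B_1(p)=\mathcal B_1(\hat\Phi(a)p)$ for all $a\in G$, $p\in H$. Then $\big((H,\cdot_{\mathcal B_1}),(G,\cdot_{\mathcal B_0}),t,\hat\Phi\big)$, where $a\cdot_{\mathcal B_i}b=a\,\mathcal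 B_i(a)\,b\,\mathcal B_i(a)^{-1}$, is again a crossed module of Lie groups. The crossed module of Lie algebras of $(H,G,t,\Phi)$ is $(\mathfrak h,\mathfrak g,\mathrm dt,\phi)$, where $\mathfrak h=T_eH$ and $\mathfrak g=T_eG$ are the Lie algebras of $H$ and $G$, $\mathrm dt=t_{*e}$, and $\phi(x)u$ is the derivative at $a=e$ in the direction $x\in\mathfrak g$ of the map $a\mapsto(\Phi(a))_{*e}u$, for $u\in\mathfrak h$. Put $B_1=(\mathcal B_1)_{*e}$ and $B_0=(\mathcal B_0)_{*e}$. Then $(B_1,B_0)$ is a Rota--Baxter operator (of weight $1$) on $(\mathfrak h,\mathfrak g,\mathrm dt,\phi)$: $B_1$ and $B_0$ are linear maps with $[B_i(x),B_i(y)]=B_i([B_i(x),y]+[x,B_i(y)]+[x,y])$ for $i=0,1$, with $\mathrm dt\circ B_1=B_0\circ\mathrm dt$, and with $\phi(B_0(x))B_1(u)=B_1(\hat\phi(x)u)$, where $$\hat\phi(x)u=\phi(x)B_1(u)+\phi(B_0(x))u+\phi(x)u .$$ Moreover, with the brackets $[x,y]_{B_i}=[B_i(x),y]+[x,B_i(y)]+[x,y]$,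 the descendent crossed module of Lie algebras $$\big((\mathfrak h,[\cdot,\cdot]_{B_1}),(\mathfrak g,[\cdot,\cdot]_{B_0}),\mathrm dt,\hat\phi\big)$$ is the crossed module of Lie algebras of $\big((H,\cdot_{\mathcal B_1}),(G,\cdot_{\mathcal B_0}),t,\hat\Phi\big)$: as Lie algebras, $(\mathfrak h,[\cdot,\cdot]_{B_1})$ and $(\mathfrak g,[\cdot,\cdot]_{B_0})$ are the Lie algebras of $(H,\cdot_{\mathcal B_1})$ and $(G,\cdot_{\mathcal B_0})$ (same tangent spaces at $e$), $\mathrm dt$ is the tangent map of $t$, and $\hat\phi$ is obtained from $\hat\Phi$ in the same way as $\phi$ from $\Phi$. -/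

import Mathlib

open scoped Manifold ContDiff

/-! ### Lie groups and their Rota-Baxter operators

A Lie group is a group `G` with a compatible smooth (`C^∞`) structure modelled on a complete real
normed space `E` (for `E` finite-dimensional: a Lie group in the usual sense). Its Lie algebra is
Mathlib's `GroupLieAlgebra 𝓘(ℝ, E) G`: the tangent space at `1`, with the bracket of left-invariant
vector fields. -/

/-- Smooth Lie groups are smooth enough for Mathlib's Lie algebra structure on the tangent space. -/
instance instLEInftyMinSmoothness : ENat.LEInfty (minSmoothness ℝ 3) :=
  ⟨by rw [minSmoothness_of_isRCLikeNormedField]; exact ENat.LEInfty.out⟩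

/-- A Rota-Baxter operator on a Lie group `G`. -/
structure GroupRotaBaxter (E : Type*) [NormedAddCommGroup E] [NormedSpace ℝ E]
    (G : Type*) [TopologicalSpace G] [ChartedSpace E G] [Group G] where
  toFun : G → G
  smooth : ContMDiff 𝓘(ℝ, E) 𝓘(ℝ, E) ∞ toFun
  mul_eq : ∀ a b : G, toFun a * toFun b = toFun (a * toFun a * b * (toFun a)⁻¹)

namespace GroupRotaBaxter

section
variable {E : Type*} [NormedAddCommGroup E] [NormedSpace ℝ E]
  {G : Type*} [TopologicalSpace G] [ChartedSpace E G] [Group G]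

instance : CoeFun (GroupRotaBaxter E G) (fun _ => G → G) := ⟨toFun⟩

theorem map_one (B : GroupRotaBaxter E G) : B 1 = 1 := by
  have h := B.mul_eq 1 1
  have h2 : (1 : G) * B 1 * 1 * (B 1)⁻¹ = 1 := by group
  rw [h2] at h
  exact mul_eq_left.mp h

/-- The descendent Lie group `(G, ·_B)`: the manifold `G` with the multiplication
`a ·_B b = a B(a) b B(a)⁻¹`. -/
def Desc (_ : GroupRotaBaxter E G) : Type _ := G

instance (B : GroupRotaBaxter E G) : TopologicalSpace B.Desc := inferInstanceAs (TopologicalSpace G)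

instance (B : GroupRotaBaxter E G) : ChartedSpace E B.Desc := inferInstanceAs (ChartedSpace E G)

/-- The product `a ·_B b`. -/
def descMul (B : GroupRotaBaxter E G) (a b : G) : G := a * B a * b * (B a)⁻¹

theorem map_descMul (B : GroupRotaBaxter E G) (a b : G) : B (B.descMul a b) = B a * B b :=
  (B.mul_eq a b).symm

theorem one_descMul (B : GroupRotaBaxter E G) (a : G) : B.descMul 1 a = a := by
  simp [descMul, map_one]

theorem descMul_one (B : GroupRotaBaxter E G) (a : G) : B.descMul a 1 = a := by
  simp [descMul]

theorem descMul_assoc (B : GroupRotaBaxter E G) (a b c : G) :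
    B.descMul (B.descMul a b) c = B.descMul a (B.descMul b c) := by
  rw [descMul, map_descMul]
  simp only [descMul]
  group

/-- The inverse of `a` for the product `·_B`. -/
def descInv (B : GroupRotaBaxter E G) (a : G) : G := (B a)⁻¹ * a⁻¹ * B a

theorem descInv_descMul (B : GroupRotaBaxter E G) (a : G) : B.descMul (B.descInv a) a = 1 := by
  have h1 : B.descMul a (B.descInv a) = 1 := by
    simp only [descMul, descInv]; group
  have h2 : B (B.descInv a) = (B a)⁻¹ := by
    have h := B.map_descMul a (B.descInv a)
    rw [h1, map_one] at h
    exact (inv_eq_of_mul_eq_one_right h.symm).symm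
  rw [descMul, h2, descInv]
  group

instance instGroupDesc (B : GroupRotaBaxter E G) : Group B.Desc where
  mul := B.descMul
  one := (1 : G)
  inv := B.descInv
  mul_assoc := B.descMul_assoc
  one_mul := B.one_descMul
  mul_one := B.descMul_one
  inv_mul_cancel := B.descInv_descMul

instance instLieGroupDesc [LieGroup 𝓘(ℝ, E) ∞ G] (B : GroupRotaBaxter E G) :
    LieGroup 𝓘(ℝ, E) ∞ B.Desc where
  toIsManifold := inferInstanceAs (IsManifold 𝓘(ℝ, E) ∞ G)
  contMDiff_mul := by
    change ContMDiff (𝓘(ℝ, E).prod 𝓘(ℝ, E)) 𝓘(ℝ, E) ∞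
      (fun p : G × G => p.1 * B p.1 * p.2 * (B p.1)⁻¹)
    have hB : ContMDiff (𝓘(ℝ, E).prod 𝓘(ℝ, E)) 𝓘(ℝ, E) ∞ (fun p : G × G => B p.1) :=
      B.smooth.comp contMDiff_fst
    exact ((contMDiff_fst.mul hB).mul contMDiff_snd).mul hB.inv
  contMDiff_inv := by
    change ContMDiff 𝓘(ℝ, E) 𝓘(ℝ, E) ∞ (fun a : G => (B a)⁻¹ * a⁻¹ * B a)
    exact (B.smooth.inv.mul contMDiff_id.inv).mul B.smooth

end

end GroupRotaBaxter

/-! ### Crossed modules of Lie groups -/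

/-- A crossed module of Lie groups `(H, G, t, Φ)`. -/
structure GroupCrossedModule (EH EG : Type*) [NormedAddCommGroup EH] [NormedSpace ℝ EH]
    [NormedAddCommGroup EG] [NormedSpace ℝ EG]
    (H : Type*) [TopologicalSpace H] [ChartedSpace EH H] [Group H]
    (G : Type*) [TopologicalSpace G] [ChartedSpace EG G] [Group G] where
  t : H →* G
  smooth_t : ContMDiff 𝓘(ℝ, EH) 𝓘(ℝ, EG) ∞ t
  act : G →* MulAut H
  smooth_act : ContMDiff (𝓘(ℝ, EG).prod 𝓘(ℝ, EH)) 𝓘(ℝ, EH) ∞ (fun z : G × H => act z.1 z.2)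
  act_t : ∀ p q : H, act (t p) q = p * q * p⁻¹
  t_act : ∀ (a : G) (p : H), t (act a p) = a * t p * a⁻¹

namespace GroupCrossedModule

section
variable {EH EG : Type*} [NormedAddCommGroup EH] [NormedSpace ℝ EH]
  [NormedAddCommGroup EG] [NormedSpace ℝ EG]
  {H : Type*} [TopologicalSpace H] [ChartedSpace EH H] [Group H]
  {G : Type*} [TopologicalSpace G] [ChartedSpace EG G] [Group G]

/-- A Rota-Baxter operator `(B₁, B₀)` on a crossed module of Lie groups `(H, G, t, Φ)`. -/
structure RotaBaxter (X : GroupCrossedModule EH EG H G) where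
  B₁ : GroupRotaBaxter EH H
  B₀ : GroupRotaBaxter EG G
  t_comm : ∀ p : H, X.t (B₁ p) = B₀ (X.t p)
  act_comm : ∀ (a : G) (p : H),
    X.act (B₀ a) (B₁ p) = B₁ (X.act (a * B₀ a) (p * B₁ p) * X.act (B₀ a) (B₁ p)⁻¹)

namespace RotaBaxter

variable {X : GroupCrossedModule EH EG H G}

/-- The map `Φ̂(a) p = Φ(a B₀(a))(p B₁(p)) Φ(B₀(a))(B₁(p)⁻¹)`. -/
def descAct (B : X.RotaBaxter) (a : G) (p : H) : H :=
  X.act (a * B.B₀ a) (p * B.B₁ p) * X.act (B.B₀ a) (B.B₁ p)⁻¹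

theorem map_descAct (B : X.RotaBaxter) (a : G) (p : H) :
    B.B₁ (B.descAct a p) = X.act (B.B₀ a) (B.B₁ p) := (B.act_comm a p).symm

theorem descAct_one (B : X.RotaBaxter) (p : H) : B.descAct 1 p = p := by
  simp [descAct, GroupRotaBaxter.map_one]

theorem descAct_descMul (B : X.RotaBaxter) (a b : G) (p : H) :
    B.descAct (B.B₀.descMul a b) p = B.descAct a (B.descAct b p) := by
  conv_rhs => rw [descAct, map_descAct]
  rw [descAct, GroupRotaBaxter.map_descMul]
  simp [descAct, GroupRotaBaxter.descMul, mul_assoc]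

theorem descAct_mul (B : X.RotaBaxter) (a : G) (p q : H) :
    B.descAct a (B.B₁.descMul p q) = B.B₁.descMul (B.descAct a p) (B.descAct a q) := by
  conv_rhs => rw [GroupRotaBaxter.descMul, map_descAct]
  rw [descAct, GroupRotaBaxter.map_descMul]
  simp [descAct, GroupRotaBaxter.descMul, mul_assoc]

/-- The map `Φ̂(a)` as an automorphism of the group `(H, ·_{B₁})`. -/
def descAut (B : X.RotaBaxter) (a : B.B₀.Desc) : MulAut B.B₁.Desc where
  toFun p := B.descAct a p
  invFun p := B.descAct (a⁻¹ : B.B₀.Desc) p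
  left_inv p := by
    refine (B.descAct_descMul (a⁻¹ : B.B₀.Desc) a p).symm.trans ?_
    refine (congrArg (fun c => B.descAct c p) (inv_mul_cancel a)).trans ?_
    exact B.descAct_one p
  right_inv p := by
    refine (B.descAct_descMul a (a⁻¹ : B.B₀.Desc) p).symm.trans ?_
    refine (congrArg (fun c => B.descAct c p) (mul_inv_cancel a)).trans ?_
    exact B.descAct_one p
  map_mul' p q := B.descAct_mul a p q

theorem t_descMul (B : X.RotaBaxter) (p q : H) :
    X.t (B.B₁.descMul p q) = B.B₀.descMul (X.t p) (X.t q) := by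
  simp [GroupRotaBaxter.descMul, B.t_comm]

theorem descAct_t (B : X.RotaBaxter) (p q : H) :
    B.B₁.descMul (B.descAct (X.t p) q) p = B.B₁.descMul p q := by
  rw [GroupRotaBaxter.descMul, map_descAct]
  simp only [descAct, GroupRotaBaxter.descMul, ← B.t_comm, ← map_mul X.t, X.act_t]
  group

theorem t_descAct (B : X.RotaBaxter) (a : G) (p : H) :
    B.B₀.descMul (X.t (B.descAct a p)) a = B.B₀.descMul a (X.t p) := by
  rw [GroupRotaBaxter.descMul, ← B.t_comm, map_descAct]
  simp only [descAct, GroupRotaBaxter.descMul, map_mul X.t, X.t_act, map_inv, B.t_comm]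
  group

/-- The descendent crossed module of Lie groups `((H, ·_{B₁}), (G, ·_{B₀}), t, Φ̂)`. -/
def desc [LieGroup 𝓘(ℝ, EH) ∞ H] [LieGroup 𝓘(ℝ, EG) ∞ G] (B : X.RotaBaxter) :
    GroupCrossedModule EH EG B.B₁.Desc B.B₀.Desc where
  t :=
    { toFun := fun p => X.t p
      map_one' := X.t.map_one
      map_mul' := B.t_descMul }
  smooth_t := X.smooth_t
  act :=
    { toFun := B.descAut
      map_one' := MulEquiv.ext fun p => B.descAct_one p
      map_mul' := fun a b => MulEquiv.ext fun p => B.descAct_descMul a b p }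
  smooth_act := by
    change ContMDiff (𝓘(ℝ, EG).prod 𝓘(ℝ, EH)) 𝓘(ℝ, EH) ∞ (fun z : G × H =>
      X.act (z.1 * B.B₀ z.1) (z.2 * B.B₁ z.2) * X.act (B.B₀ z.1) (B.B₁ z.2)⁻¹)
    have h0 : ContMDiff (𝓘(ℝ, EG).prod 𝓘(ℝ, EH)) 𝓘(ℝ, EG) ∞ (fun z : G × H => B.B₀ z.1) :=
      B.B₀.smooth.comp contMDiff_fst
    have h1 : ContMDiff (𝓘(ℝ, EG).prod 𝓘(ℝ, EH)) 𝓘(ℝ, EH) ∞ (fun z : G × H => B.B₁ z.2) :=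
      B.B₁.smooth.comp contMDiff_snd
    exact (X.smooth_act.comp ((contMDiff_fst.mul h0).prodMk (contMDiff_snd.mul h1))).mul
      (X.smooth_act.comp (h0.prodMk h1.inv))
  act_t := fun p q => eq_mul_inv_of_mul_eq (B.descAct_t p q)
  t_act := fun a p => eq_mul_inv_of_mul_eq (B.t_descAct a p)

end RotaBaxter

/-- The action `Φ_* : 𝔤 → (𝔥 → 𝔥)` induced by `Φ`: the automorphism `Φ(a)` of `H` fixes `1`, and
has there the tangent map `Φ̄(a) : 𝔥 → 𝔥`; then `Φ_*(x) u` is the derivative of `a ↦ Φ̄(a) u` at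
`a = 1` in the direction `x`. -/
noncomputable def tangentAct (X : GroupCrossedModule EH EG H G)
    (x : GroupLieAlgebra 𝓘(ℝ, EG) G) (u : GroupLieAlgebra 𝓘(ℝ, EH) H) :
    GroupLieAlgebra 𝓘(ℝ, EH) H :=
  mfderiv 𝓘(ℝ, EG) 𝓘(ℝ, EH)
    (fun a : G => (mfderiv 𝓘(ℝ, EH) 𝓘(ℝ, EH) (fun p : H => X.act a p) (1 : H) u : EH)) (1 : G) x

end

end GroupCrossedModule

/-! ### Lie algebras, their Rota-Baxter operators and their crossed modules -/

/-- A Rota-Baxter operator (of weight `1`) on a Lie algebra. -/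
structure LieRotaBaxter (𝕜 : Type*) [CommRing 𝕜] (L : Type*) [LieRing L] [LieAlgebra 𝕜 L] where
  toLin : L →ₗ[𝕜] L
  lie_eq : ∀ x y : L, ⁅toLin x, toLin y⁆ = toLin (⁅toLin x, y⁆ + ⁅x, toLin y⁆ + ⁅x, y⁆)

namespace LieRotaBaxter

section
variable {𝕜 : Type*} [CommRing 𝕜] {L : Type*} [LieRing L] [LieAlgebra 𝕜 L]

instance : CoeFun (LieRotaBaxter 𝕜 L) (fun _ => L → L) := ⟨fun b => b.toLin⟩

/-- The descendent Lie algebra `(L, [·,·]_b)`: the module `L` with the bracket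
`[x, y]_b = [b x, y] + [x, b y] + [x, y]`. -/
def Desc (_ : LieRotaBaxter 𝕜 L) : Type _ := L

instance (b : LieRotaBaxter 𝕜 L) : AddCommGroup b.Desc := inferInstanceAs (AddCommGroup L)

instance instModuleDesc (b : LieRotaBaxter 𝕜 L) : Module 𝕜 b.Desc := inferInstanceAs (Module 𝕜 L)

/-- The bracket `[x, y]_b`. -/
def descLie (b : LieRotaBaxter 𝕜 L) (x y : L) : L := ⁅b x, y⁆ + ⁅x, b y⁆ + ⁅x, y⁆

theorem map_descLie (b : LieRotaBaxter 𝕜 L) (x y : L) : b (b.descLie x y) = ⁅b x, b y⁆ :=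
  (b.lie_eq x y).symm

theorem add_descLie (b : LieRotaBaxter 𝕜 L) (x y z : L) :
    b.descLie (x + y) z = b.descLie x z + b.descLie y z := by
  simp only [descLie, map_add, add_lie]
  abel

theorem descLie_add (b : LieRotaBaxter 𝕜 L) (x y z : L) :
    b.descLie x (y + z) = b.descLie x y + b.descLie x z := by
  simp only [descLie, map_add, lie_add]
  abel

theorem descLie_self (b : LieRotaBaxter 𝕜 L) (x : L) : b.descLie x x = 0 := by
  simp only [descLie, lie_self, add_zero]
  rw [← lie_skew]
  exact neg_add_cancel _

theorem descLie_leibniz (b : LieRotaBaxter 𝕜 L) (x y z : L) :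
    b.descLie x (b.descLie y z) =
      b.descLie (b.descLie x y) z + b.descLie y (b.descLie x z) := by
  rw [descLie.eq_1 b x (b.descLie y z), map_descLie, descLie.eq_1 b (b.descLie x y), map_descLie,
    descLie.eq_1 b y (b.descLie x z), map_descLie]
  simp only [descLie, lie_add, add_lie, leibniz_lie (b x), leibniz_lie x]
  abel

theorem descLie_smul (b : LieRotaBaxter 𝕜 L) (c : 𝕜) (x y : L) :
    b.descLie x (c • y) = c • b.descLie x y := by
  simp only [descLie, map_smul, lie_smul, smul_add]

instance instLieRingDesc (b : LieRotaBaxter 𝕜 L) : LieRing b.Desc where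
  bracket := b.descLie
  add_lie := b.add_descLie
  lie_add := b.descLie_add
  lie_self := b.descLie_self
  leibniz_lie := b.descLie_leibniz

instance instLieAlgebraDesc (b : LieRotaBaxter 𝕜 L) : LieAlgebra 𝕜 b.Desc where
  lie_smul := b.descLie_smul

end

end LieRotaBaxter

/-- A crossed module of Lie algebras `(𝔥, 𝔤, dt, φ)`. -/
structure LieCrossedModule (𝕜 : Type*) [CommRing 𝕜] (h g : Type*) [LieRing h] [LieAlgebra 𝕜 h]
    [LieRing g] [LieAlgebra 𝕜 g] where
  dt : h →ₗ⁅𝕜⁆ g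
  φ : g →ₗ⁅𝕜⁆ LieDerivation 𝕜 h h
  dt_φ : ∀ (x : g) (u : h), dt (φ x u) = ⁅x, dt u⁆
  φ_dt : ∀ u v : h, φ (dt u) v = ⁅u, v⁆

namespace LieCrossedModule

section
variable {𝕜 : Type*} [CommRing 𝕜] {h g : Type*} [LieRing h] [LieAlgebra 𝕜 h]
  [LieRing g] [LieAlgebra 𝕜 g]

/-- A Rota-Baxter operator `(B₁, B₀)` on a crossed module of Lie algebras `(𝔥, 𝔤, dt, φ)`. -/
structure RotaBaxter (Y : LieCrossedModule 𝕜 h g) where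
  B₁ : LieRotaBaxter 𝕜 h
  B₀ : LieRotaBaxter 𝕜 g
  dt_comm : ∀ u : h, Y.dt (B₁ u) = B₀ (Y.dt u)
  φ_comm : ∀ (x : g) (u : h), Y.φ (B₀ x) (B₁ u) = B₁ (Y.φ x (B₁ u) + Y.φ (B₀ x) u + Y.φ x u)

namespace RotaBaxter

variable {Y : LieCrossedModule 𝕜 h g}

/-- The map `φ̂(x) u = φ(x) B₁(u) + φ(B₀(x)) u + φ(x) u`. -/
def descφ (B : Y.RotaBaxter) (x : g) (u : h) : h := Y.φ x (B.B₁ u) + Y.φ (B.B₀ x) u + Y.φ x u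

theorem map_descφ (B : Y.RotaBaxter) (x : g) (u : h) :
    B.B₁ (B.descφ x u) = Y.φ (B.B₀ x) (B.B₁ u) := (B.φ_comm x u).symm

theorem descφ_descLie (B : Y.RotaBaxter) (x : g) (u v : h) :
    B.descφ x (B.B₁.descLie u v) =
      B.B₁.descLie u (B.descφ x v) - B.B₁.descLie v (B.descφ x u) := by
  rw [LieRotaBaxter.descLie.eq_1 B.B₁ u (B.descφ x v),
    LieRotaBaxter.descLie.eq_1 B.B₁ v (B.descφ x u), map_descφ, map_descφ,
    descφ, LieRotaBaxter.map_descLie]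
  simp only [descφ, LieRotaBaxter.descLie, map_add, LieDerivation.apply_lie_eq_sub, lie_add]
  abel

theorem descLie_descφ (B : Y.RotaBaxter) (x y : g) (u : h) :
    B.descφ (B.B₀.descLie x y) u = B.descφ x (B.descφ y u) - B.descφ y (B.descφ x u) := by
  rw [descφ.eq_1 B x (B.descφ y u), descφ.eq_1 B y (B.descφ x u), map_descφ, map_descφ,
    descφ, LieRotaBaxter.map_descLie]
  simp only [descφ, LieRotaBaxter.descLie, map_add, LieHom.map_lie, LieDerivation.add_apply,
    LieDerivation.lie_apply]
  abel

theorem descφ_add (B : Y.RotaBaxter) (x : g) (u v : h) :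
    B.descφ x (u + v) = B.descφ x u + B.descφ x v := by
  simp only [descφ, map_add]
  abel

theorem descφ_smul (B : Y.RotaBaxter) (c : 𝕜) (x : g) (u : h) :
    B.descφ x (c • u) = c • B.descφ x u := by
  simp only [descφ, map_smul, smul_add]

theorem add_descφ (B : Y.RotaBaxter) (x y : g) (u : h) :
    B.descφ (x + y) u = B.descφ x u + B.descφ y u := by
  simp only [descφ, map_add, LieDerivation.add_apply]
  abel

theorem smul_descφ (B : Y.RotaBaxter) (c : 𝕜) (x : g) (u : h) :
    B.descφ (c • x) u = c • B.descφ x u := by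
  simp only [descφ, map_smul, LieDerivation.smul_apply, smul_add]

theorem dt_descLie (B : Y.RotaBaxter) (u v : h) :
    Y.dt (B.B₁.descLie u v) = B.B₀.descLie (Y.dt u) (Y.dt v) := by
  simp only [LieRotaBaxter.descLie, map_add, LieHom.map_lie, B.dt_comm]

theorem dt_descφ (B : Y.RotaBaxter) (x : g) (u : h) :
    Y.dt (B.descφ x u) = B.B₀.descLie x (Y.dt u) := by
  simp only [descφ, LieRotaBaxter.descLie, map_add, Y.dt_φ, B.dt_comm]
  abel

theorem descφ_dt (B : Y.RotaBaxter) (u v : h) : B.descφ (Y.dt u) v = B.B₁.descLie u v := by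
  simp only [descφ, LieRotaBaxter.descLie, ← B.dt_comm, Y.φ_dt]
  abel

/-- The descendent crossed module of Lie algebras `((𝔥, [·,·]_{B₁}), (𝔤, [·,·]_{B₀}), dt, φ̂)`. -/
def desc (B : Y.RotaBaxter) : LieCrossedModule 𝕜 B.B₁.Desc B.B₀.Desc where
  dt :=
    { toFun := fun u => Y.dt u
      map_add' := Y.dt.map_add
      map_smul' := Y.dt.map_smul
      map_lie' := fun {u v} => B.dt_descLie u v }
  φ :=
    { toFun := fun x =>
        { toFun := fun u => B.descφ x u
          map_add' := B.descφ_add x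
          map_smul' := fun c u => B.descφ_smul c x u
          leibniz' := B.descφ_descLie x }
      map_add' := fun x y => LieDerivation.ext fun u => B.add_descφ x y u
      map_smul' := fun c x => LieDerivation.ext fun u => B.smul_descφ c x u
      map_lie' := fun {x y} => LieDerivation.ext fun u => by
        rw [LieDerivation.lie_apply]
        exact B.descLie_descφ x y u }
  dt_φ := B.dt_descφ
  φ_dt := B.descφ_dt

end RotaBaxter

end

section
variable {EH EG : Type*} [NormedAddCommGroup EH] [NormedSpace ℝ EH] [CompleteSpace EH]
  [NormedAddCommGroup EG] [NormedSpace ℝ EG] [CompleteSpace EG]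
  {H : Type*} [TopologicalSpace H] [ChartedSpace EH H] [Group H] [LieGroup 𝓘(ℝ, EH) ∞ H]
  {G : Type*} [TopologicalSpace G] [ChartedSpace EG G] [Group G] [LieGroup 𝓘(ℝ, EG) ∞ G]
  {h g : Type*} [LieRing h] [LieAlgebra ℝ h] [LieRing g] [LieAlgebra ℝ g]

/-- `Y = (𝔥, 𝔤, dt, φ)` is the crossed module of Lie algebras of the crossed module of Lie groups
`X = (H, G, t, Φ)`, where `𝔥` and `𝔤` are identified with the Lie algebras of `H` and `G` by the Lie
algebra isomorphisms `eh` and `eg`: `dt` is the tangent map of `t` at `1`, and `φ = Φ_*`. -/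
structure IsCrossedModuleOf (Y : LieCrossedModule ℝ h g) (X : GroupCrossedModule EH EG H G)
    (eh : h ≃ₗ⁅ℝ⁆ GroupLieAlgebra 𝓘(ℝ, EH) H) (eg : g ≃ₗ⁅ℝ⁆ GroupLieAlgebra 𝓘(ℝ, EG) G) :
    Prop where
  dt_eq : ∀ u : h, eg (Y.dt u) = mfderiv 𝓘(ℝ, EH) 𝓘(ℝ, EG) X.t (1 : H) (eh u)
  φ_eq : ∀ (x : g) (u : h), eh (Y.φ x u) = X.tangentAct (eg x) (eh u)

end

end LieCrossedModule

/-! Every bracket and every infinitesimal action here has one form: the derivative at `1`, in the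
parameter, of the tangent maps at `1` of a smooth family `α a` of maps fixing `1`. This is
`tangentAction`. The family `Φ` gives `φ`, the family `Φ̂` gives `φ̂`, and conjugation gives the Lie
bracket.

The last claim is the analytic input (`GroupLieAlgebra.lie_eq_tangentAt_conj`), since the bracket is
defined by left-invariant vector fields. In the chart at `1`, left translation by `x` is conjugation
by `x` followed by right translation by `x`. Differentiating this relation, the mixed second
derivatives of the product cancel by symmetry, and only the derivative of the adjoint action
remains.

The algebra rests on naturality (`IsPointedFamily.tangentAction_map`): if `h (α a p) = β (f a) (h
p)`, the tangent maps of `f` and `h` intertwine the two infinitesimal actions. It yields that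
tangent maps of homomorphisms preserve brackets, both compatibilities between `dt` and `φ`, and the
condition on `φ (B₀ x) (B₁ u)`. Two further identities, that `φ x` is a derivation and that `φ`
preserves brackets, come from differentiating an instance of naturality once more.

One computation remains, `RotaBaxter.tangentAction_descAct`: it differentiates the formula for `Φ̂`
and finds `φ̂`. Applied to the crossed module `(G, G, id, Ad)`, where `Φ̂` is conjugation for `·_B`,
it also gives the bracket of the descendent group. The Rota-Baxter identity follows because `B` is a
homomorphism from the descendent group to `G`. -/

/-! ### Tangent maps between the model spaces -/

section Tangent

variable {E F P : Type*} [NormedAddCommGroup E] [NormedSpace ℝ E]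
  [NormedAddCommGroup F] [NormedSpace ℝ F] [NormedAddCommGroup P] [NormedSpace ℝ P]
  {M N Q : Type*} [TopologicalSpace M] [ChartedSpace E M] [TopologicalSpace N] [ChartedSpace F N]
  [TopologicalSpace Q] [ChartedSpace P Q]

variable (E F) in
/-- The tangent map of `f` at `x`, as a map between the model spaces. -/
noncomputable def tangentAt (f : M → N) (x : M) : E →L[ℝ] F :=
  mfderiv 𝓘(ℝ, E) 𝓘(ℝ, F) f x

theorem tangentAt_comp {f : M → N} {g : N → Q} {x : M} {y : N}
    (hg : MDifferentiableAt 𝓘(ℝ, F) 𝓘(ℝ, P) g y) (hf : MDifferentiableAt 𝓘(ℝ, E) 𝓘(ℝ, F) f x)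
    (hy : f x = y) :
    tangentAt E P (fun z => g (f z)) x = (tangentAt F P g y).comp (tangentAt E F f x) := by
  subst hy
  exact mfderiv_comp x hg hf

theorem tangentAt_eq_fderiv (f : E → F) (x : E) : tangentAt E F f x = fderiv ℝ f x :=
  mfderiv_eq_fderiv

theorem tangentAt_id (x : M) : tangentAt E E (fun z : M => z) x = ContinuousLinearMap.id ℝ E :=
  mfderiv_id

theorem tangentAt_const (c : N) (x : M) : tangentAt E F (fun _ : M => c) x = (0 : E →L[ℝ] F) :=
  mfderiv_const

theorem tangentAt_apply₂ {P' : Type*} [NormedAddCommGroup P'] [NormedSpace ℝ P']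
    {Q' : Type*} [TopologicalSpace Q'] [ChartedSpace P' Q']
    {m : N × Q → Q'} {f : M → N} {g : M → Q} {x : M} {y : N} {z : Q}
    (hm : MDifferentiableAt (𝓘(ℝ, F).prod 𝓘(ℝ, P)) 𝓘(ℝ, P') m (y, z))
    (hf : MDifferentiableAt 𝓘(ℝ, E) 𝓘(ℝ, F) f x)
    (hg : MDifferentiableAt 𝓘(ℝ, E) 𝓘(ℝ, P) g x) (hy : f x = y) (hz : g x = z) :
    tangentAt E P' (fun w => m (f w, g w)) x =
      (tangentAt F P' (fun w => m (w, z)) y).comp (tangentAt E F f x) +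
        (tangentAt P P' (fun w => m (y, w)) z).comp (tangentAt E P g x) := by
  subst hy hz
  have h1 := mfderiv_comp x hm (hf.prodMk hg)
  rw [mfderiv_prodMk hf hg, mfderiv_prod_eq_add_comp hm] at h1
  ext v
  exact congrArg (fun L : E →L[ℝ] P' => L v) h1

variable (x₀ : M)

/-- The tangent space at `x₀` is identified with `E` by the preferred chart at `x₀` itself, so this
is the coordinate change from a chart to itself. -/
theorem tangentAt_extChartAt [IsManifold 𝓘(ℝ, E) 1 M] :
    tangentAt E E (extChartAt 𝓘(ℝ, E) x₀) x₀ = ContinuousLinearMap.id ℝ E := by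
  have h1 := (hasMFDerivAt_extChartAt (I := 𝓘(ℝ, E)) (mem_chart_source E x₀)).mfderiv
  rw [mfderiv_chartAt_eq_tangentCoordChange (mem_chart_source E x₀)] at h1
  ext v
  refine (congrArg (fun L : E →L[ℝ] E => L v) h1).trans ?_
  exact tangentCoordChange_self (mem_extChartAt_source x₀)

variable {x₀}

theorem mdifferentiableAt_extChartAt_symm [IsManifold 𝓘(ℝ, E) 1 M] {y : E}
    (hy : y ∈ (extChartAt 𝓘(ℝ, E) x₀).target) :
    MDifferentiableAt 𝓘(ℝ, E) 𝓘(ℝ, E) (extChartAt 𝓘(ℝ, E) x₀).symm y := by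
  have h := mdifferentiableWithinAt_extChartAt_symm hy
  rwa [ModelWithCorners.range_eq_univ, mdifferentiableWithinAt_univ] at h

theorem tangentAt_extChartAt_comp_symm [IsManifold 𝓘(ℝ, E) 1 M] {y : E}
    (hy : y ∈ (extChartAt 𝓘(ℝ, E) x₀).target) :
    (tangentAt E E (extChartAt 𝓘(ℝ, E) x₀) ((extChartAt 𝓘(ℝ, E) x₀).symm y)).comp
      (tangentAt E E (extChartAt 𝓘(ℝ, E) x₀).symm y) = ContinuousLinearMap.id ℝ E := by
  have h := mfderiv_extChartAt_comp_mfderivWithin_extChartAt_symm hy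
  rw [ModelWithCorners.range_eq_univ, mfderivWithin_univ] at h
  exact h

theorem tangentAt_extChartAt_symm_comp [IsManifold 𝓘(ℝ, E) 1 M] {y : E}
    (hy : y ∈ (extChartAt 𝓘(ℝ, E) x₀).target) :
    (tangentAt E E (extChartAt 𝓘(ℝ, E) x₀).symm y).comp
      (tangentAt E E (extChartAt 𝓘(ℝ, E) x₀) ((extChartAt 𝓘(ℝ, E) x₀).symm y)) =
        ContinuousLinearMap.id ℝ E := by
  have h := mfderivWithin_extChartAt_symm_comp_mfderiv_extChartAt hy
  rw [ModelWithCorners.range_eq_univ, mfderivWithin_univ] at h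
  exact h

variable (x₀) in
theorem tangentAt_extChartAt_symm [IsManifold 𝓘(ℝ, E) 1 M] :
    tangentAt E E (extChartAt 𝓘(ℝ, E) x₀).symm (extChartAt 𝓘(ℝ, E) x₀ x₀) =
      ContinuousLinearMap.id ℝ E := by
  have h := tangentAt_extChartAt_comp_symm (mem_extChartAt_target (I := 𝓘(ℝ, E)) x₀)
  rw [extChartAt_to_inv, tangentAt_extChartAt] at h
  exact h

/-- Around a point fixed by all the maps `f a`, the tangent maps depend smoothly on `a`. -/
theorem mdifferentiableAt_tangentAt [IsManifold 𝓘(ℝ, E) 1 M] [IsManifold 𝓘(ℝ, F) 1 N]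
    [IsManifold 𝓘(ℝ, P) 1 Q] {f : Q → M → N} {y₀ : N} {a : Q}
    (hf : ContMDiffAt (𝓘(ℝ, P).prod 𝓘(ℝ, E)) 𝓘(ℝ, F) ∞ (fun z : Q × M => f z.1 z.2) (a, x₀))
    (hy : ∀ b, f b x₀ = y₀) :
    MDifferentiableAt 𝓘(ℝ, P) 𝓘(ℝ, E →L[ℝ] F) (fun b => tangentAt E F (f b) x₀) a := by
  -- Smooth dependence of tangent maps is known in tangent coordinates. Here the base point `x₀` and
  -- its image `y₀` do not move with `b`, so both coordinate changes are the identity.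
  have h : MDifferentiableAt 𝓘(ℝ, P) 𝓘(ℝ, E →L[ℝ] F)
      (inTangentCoordinates 𝓘(ℝ, E) 𝓘(ℝ, F) (fun _ => x₀) (fun b => f b x₀)
        (fun b => tangentAt E F (f b) x₀) a) a :=
    (ContMDiffAt.mfderiv (m := 1) f (fun _ => x₀) hf contMDiffAt_const (by
      rw [one_add_one_eq_two]; exact ENat.LEInfty.out)).mdifferentiableAt one_ne_zero
  refine (funext fun b => ?_ : (fun b => tangentAt E F (f b) x₀) = _) ▸ h
  rw [inTangentCoordinates_eq (x₀ := a) (x := b) _ _ _ (mem_chart_source _ _) (by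
    rw [hy, hy]; exact mem_chart_source _ _)]
  ext v
  simp only [hy, ContinuousLinearMap.comp_apply]
  have e1 : ((tangentBundleCore 𝓘(ℝ, E) M).coordChange (achart E x₀) (achart E x₀) x₀) v = v :=
    (tangentBundleCore 𝓘(ℝ, E) M).coordChange_self _ _ (mem_chart_source E x₀) v
  rw [e1]
  exact ((tangentBundleCore 𝓘(ℝ, F) N).coordChange_self _ _ (mem_chart_source F y₀) _).symm

end Tangent

/-! ### The bracket of left-invariant vector fields in a local chart -/

section LocalGroup

variable {E : Type*} [NormedAddCommGroup E] [NormedSpace ℝ E]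

theorem fderiv_partial_right {F P : Type*} [NormedAddCommGroup F] [NormedSpace ℝ F]
    [NormedAddCommGroup P] [NormedSpace ℝ P] {m : E × F → P} {x : E} {y : F}
    (h : DifferentiableAt ℝ m (x, y)) (v : F) :
    fderiv ℝ (fun z => m (x, z)) y v = fderiv ℝ m (x, y) (0, v) := by
  have h1 := h.hasFDerivAt.comp y (hasFDerivAt_prodMk_right x y)
  exact congrArg (fun L : F →L[ℝ] P => L v) h1.fderiv

theorem fderiv_partial_left {F P : Type*} [NormedAddCommGroup F] [NormedSpace ℝ F]
    [NormedAddCommGroup P] [NormedSpace ℝ P] {m : E × F → P} {x : E} {y : F}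
    (h : DifferentiableAt ℝ m (x, y)) (v : E) :
    fderiv ℝ (fun z => m (z, y)) x v = fderiv ℝ m (x, y) (v, 0) := by
  have h1 := HasFDerivAt.comp (f := fun z => (z, y)) x h.hasFDerivAt (hasFDerivAt_prodMk_left x y)
  exact congrArg (fun L : E →L[ℝ] P => L v) h1.fderiv

/-- For a local product `m` with unit `e`, the bracket of the left-invariant vector fields is the
derivative of the adjoint action `c`. -/
theorem lieBracket_leftInvariant_eq {m : E × E → E} {e : E} {c : E → E →L[ℝ] E}
    (hm : ContDiffAt ℝ 2 m (e, e)) (h1 : ∀ᶠ x in nhds e, m (x, e) = x)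
    (h2 : ∀ᶠ x in nhds e, m (e, x) = x) (hc : DifferentiableAt ℝ c e)
    (hce : c e = ContinuousLinearMap.id ℝ E)
    (hmc : ∀ᶠ x in nhds e, ∀ v, fderiv ℝ (fun y => m (x, y)) e v =
      fderiv ℝ (fun y => m (y, x)) e (c x v)) (v w : E) :
    VectorField.lieBracket ℝ (fun x => fderiv ℝ (fun y => m (x, y)) e v)
      (fun x => fderiv ℝ (fun y => m (x, y)) e w) e = fderiv ℝ c e v w := by
  have hD : DifferentiableAt ℝ (fderiv ℝ m) (e, e) :=
    (hm.fderiv_right (m := 1) (by rw [one_add_one_eq_two])).differentiableAt one_ne_zero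
  have hsymm : IsSymmSndFDerivAt ℝ m (e, e) :=
    hm.isSymmSndFDerivAt (by rw [minSmoothness_of_isRCLikeNormedField])
  have hev : ∀ᶠ z in nhds (e, e), DifferentiableAt ℝ m z := by
    filter_upwards [hm.eventually (by simp)] with z hz using hz.differentiableAt two_ne_zero
  have hl : ∀ᶠ x in nhds e, DifferentiableAt ℝ m (x, e) :=
    (ContinuousAt.prodMk continuousAt_id continuousAt_const : ContinuousAt (fun x => (x, e)) e) hev
  have hr : ∀ᶠ x in nhds e, DifferentiableAt ℝ m (e, x) :=
    (ContinuousAt.prodMk continuousAt_const continuousAt_id : ContinuousAt (fun x => (e, x)) e) hev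
  have hL : ∀ u, HasFDerivAt (fun x => fderiv ℝ (fun y => m (x, y)) e u)
      (((fderiv ℝ (fderiv ℝ m) (e, e)).comp (ContinuousLinearMap.inl ℝ E E)).flip (0, u)) e := by
    intro u
    have h := (HasFDerivAt.comp (f := fun z => (z, e)) e hD.hasFDerivAt (hasFDerivAt_prodMk_left e e)).clm_apply
      (hasFDerivAt_const ((0 : E), u) e)
    refine (h.congr_of_eventuallyEq ?_).congr_fderiv ?_
    · filter_upwards [hl] with x hx using fderiv_partial_right hx u
    · ext w
      simp
  -- Product rule: `x` occurs in the base point `(e, x)` and in `c x u`. The second contribution is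
  -- just `fderiv ℝ c e w u`, because `m (·, e)` is the identity near `e`.
  have hR : ∀ u, HasFDerivAt (fun x => fderiv ℝ (fun y => m (y, x)) e (c x u))
      (((fderiv ℝ (fderiv ℝ m) (e, e)).comp (ContinuousLinearMap.inr ℝ E E)).flip (u, 0)
        + (fderiv ℝ c e).flip u) e := by
    intro u
    have h := (hD.hasFDerivAt.comp e (hasFDerivAt_prodMk_right e e)).clm_apply
      ((ContinuousLinearMap.inl ℝ E E).hasFDerivAt.comp e
        (hc.hasFDerivAt.clm_apply (hasFDerivAt_const u e)))
    refine (h.congr_of_eventuallyEq ?_).congr_fderiv ?_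
    · filter_upwards [hr] with x hx using fderiv_partial_left hx (c x u)
    · ext w
      have hid : fderiv ℝ m (e, e) (fderiv ℝ c e w u, 0) = fderiv ℝ c e w u := by
        rw [← fderiv_partial_left hl.self_of_nhds,
          Filter.EventuallyEq.fderiv_eq (f := fun z => z) h1]
        simp
      simp [hce, hid, add_comm]
  -- Equate the derivatives of the two expressions for the left-invariant field. Symmetry of the
  -- second derivative makes the mixed terms those of the Lie bracket.
  have key : ∀ u w, fderiv ℝ (fderiv ℝ m) (e, e) (w, 0) (0, u) =
      fderiv ℝ (fderiv ℝ m) (e, e) (u, 0) (0, w) + fderiv ℝ c e w u := by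
    intro u w
    have h := (hL u).unique ((hR u).congr_of_eventuallyEq (hmc.mono fun x hx => hx u))
    have h' := congrArg (fun L : E →L[ℝ] E => L w) h
    rw [hsymm (u, 0) (0, w)]
    simpa using h'
  have hid : ∀ u, fderiv ℝ (fun y => m (e, y)) e u = u := by
    intro u
    rw [Filter.EventuallyEq.fderiv_eq (f := fun z => z) h2]
    simp
  rw [VectorField.lieBracket_eq]
  simp only [hid, (hL v).fderiv, (hL w).fderiv]
  have := key w v
  simp only [ContinuousLinearMap.flip_apply, ContinuousLinearMap.comp_apply,
    ContinuousLinearMap.inl_apply]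
  rw [this, add_sub_cancel_left]

end LocalGroup

/-! ### The bracket of the Lie algebra of a Lie group is the differential of the adjoint action -/

section Adjoint

variable {E : Type*} [NormedAddCommGroup E] [NormedSpace ℝ E]
  {G : Type*} [TopologicalSpace G] [ChartedSpace E G] [Group G]

variable (E G) in
/-- The product of `G` in the chart at `1`. -/
noncomputable def chartMul (z : E × E) : E :=
  extChartAt 𝓘(ℝ, E) (1 : G)
    ((extChartAt 𝓘(ℝ, E) (1 : G)).symm z.1 * (extChartAt 𝓘(ℝ, E) (1 : G)).symm z.2)

local notation "χ" => extChartAt 𝓘(ℝ, E) (1 : G)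

theorem eventually_chartMul_right : ∀ᶠ x in nhds (χ 1), chartMul E G (x, χ 1) = x := by
  filter_upwards [extChartAt_target_mem_nhds (I := 𝓘(ℝ, E)) (1 : G)] with x hx
  rw [chartMul, extChartAt_to_inv, mul_one, (χ).right_inv hx]

theorem eventually_chartMul_left : ∀ᶠ x in nhds (χ 1), chartMul E G (χ 1, x) = x := by
  filter_upwards [extChartAt_target_mem_nhds (I := 𝓘(ℝ, E)) (1 : G)] with x hx
  rw [chartMul, extChartAt_to_inv, one_mul, (χ).right_inv hx]

variable [LieGroup 𝓘(ℝ, E) ∞ G]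

theorem contDiffAt_chartMul : ContDiffAt ℝ ∞ (chartMul E G) (χ 1, χ 1) := by
  rw [← contMDiffAt_iff_contDiffAt]
  have hs : ContMDiffAt 𝓘(ℝ, E) 𝓘(ℝ, E) ∞ (χ).symm (χ 1) :=
    (contMDiffOn_extChartAt_symm (1 : G)).contMDiffAt (extChartAt_target_mem_nhds 1)
  have h1 : ContMDiffAt 𝓘(ℝ, E × E) 𝓘(ℝ, E) ∞ (fun z : E × E => (χ).symm z.1) (χ 1, χ 1) :=
    ContMDiffAt.comp (g := (χ).symm) (f := Prod.fst) _ hs contDiff_fst.contMDiff.contMDiffAt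
  have h2 : ContMDiffAt 𝓘(ℝ, E × E) 𝓘(ℝ, E) ∞ (fun z : E × E => (χ).symm z.2) (χ 1, χ 1) :=
    ContMDiffAt.comp (g := (χ).symm) (f := Prod.snd) _ hs contDiff_snd.contMDiff.contMDiffAt
  refine ContMDiffAt.comp (g := χ) _ ?_ (h1.mul h2)
  simp only [extChartAt_to_inv, mul_one]
  exact contMDiffAt_extChartAt

theorem contMDiff_conj :
    ContMDiff (𝓘(ℝ, E).prod 𝓘(ℝ, E)) 𝓘(ℝ, E) ∞ (fun z : G × G => z.1 * z.2 * z.1⁻¹) :=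
  (contMDiff_fst.mul contMDiff_snd).mul contMDiff_fst.inv

theorem mdifferentiableAt_mul_const (a b : G) :
    MDifferentiableAt 𝓘(ℝ, E) 𝓘(ℝ, E) (fun z : G => z * a) b :=
  (contMDiff_mul_right (I := 𝓘(ℝ, E)) (n := ∞) (a := a)).mdifferentiableAt (by simp)

theorem mdifferentiableAt_const_mul (a b : G) :
    MDifferentiableAt 𝓘(ℝ, E) 𝓘(ℝ, E) (fun z : G => a * z) b :=
  (contMDiff_mul_left (I := 𝓘(ℝ, E)) (n := ∞) (a := a)).mdifferentiableAt (by simp)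

theorem mdifferentiableAt_conj (a b : G) :
    MDifferentiableAt 𝓘(ℝ, E) 𝓘(ℝ, E) (fun z : G => a * z * a⁻¹) b :=
  (mdifferentiableAt_mul_const a⁻¹ (a * b)).comp b (mdifferentiableAt_const_mul a b)

theorem mdifferentiableAt_tangentAt_conj :
    MDifferentiableAt 𝓘(ℝ, E) 𝓘(ℝ, E →L[ℝ] E)
      (fun a : G => tangentAt E E (fun b : G => a * b * a⁻¹) 1) 1 :=
  mdifferentiableAt_tangentAt (y₀ := 1) (f := fun a b : G => a * b * a⁻¹)
    contMDiff_conj.contMDiffAt (by simp)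

theorem mdifferentiableAt_extChartAt_of_mem_target {x : E} (hx : x ∈ (χ).target) :
    MDifferentiableAt 𝓘(ℝ, E) 𝓘(ℝ, E) χ ((χ).symm x) :=
  mdifferentiableAt_extChartAt (by
    have := (χ).map_target hx
    rwa [extChartAt_source] at this)

/-- Chain rule; the inverse chart contributes nothing, its tangent map at the image of `1` being the
identity. -/
theorem fderiv_chartMul_left {x : E} (hx : x ∈ (χ).target) :
    fderiv ℝ (fun y => chartMul E G (x, y)) (χ 1) =
      (tangentAt E E χ ((χ).symm x)).comp (tangentAt E E (fun b : G => (χ).symm x * b) 1) := by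
  rw [← tangentAt_eq_fderiv]
  have h1 : MDifferentiableAt 𝓘(ℝ, E) 𝓘(ℝ, E) (fun y => (χ).symm x * (χ).symm y) (χ 1) :=
    (mdifferentiableAt_const_mul ((χ).symm x) ((χ).symm (χ 1))).comp _
      (mdifferentiableAt_extChartAt_symm (mem_extChartAt_target _))
  refine (tangentAt_comp (mdifferentiableAt_extChartAt_of_mem_target hx) h1
    (by rw [extChartAt_to_inv, mul_one])).trans ?_
  rw [tangentAt_comp (mdifferentiableAt_const_mul ((χ).symm x) 1)
    (mdifferentiableAt_extChartAt_symm (mem_extChartAt_target _)) (extChartAt_to_inv _),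
    tangentAt_extChartAt_symm, ContinuousLinearMap.comp_id]

theorem fderiv_chartMul_right {x : E} (hx : x ∈ (χ).target) :
    fderiv ℝ (fun y => chartMul E G (y, x)) (χ 1) =
      (tangentAt E E χ ((χ).symm x)).comp (tangentAt E E (fun b : G => b * (χ).symm x) 1) := by
  rw [← tangentAt_eq_fderiv]
  have h1 : MDifferentiableAt 𝓘(ℝ, E) 𝓘(ℝ, E) (fun y => (χ).symm y * (χ).symm x) (χ 1) :=
    (mdifferentiableAt_mul_const ((χ).symm x) ((χ).symm (χ 1))).comp _
      (mdifferentiableAt_extChartAt_symm (mem_extChartAt_target _))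
  refine (tangentAt_comp (mdifferentiableAt_extChartAt_of_mem_target hx) h1
    (by rw [extChartAt_to_inv, one_mul])).trans ?_
  rw [tangentAt_comp (mdifferentiableAt_mul_const ((χ).symm x) 1)
    (mdifferentiableAt_extChartAt_symm (mem_extChartAt_target _)) (extChartAt_to_inv _),
    tangentAt_extChartAt_symm, ContinuousLinearMap.comp_id]

/-- Differentiate `g * b = (g * b * g⁻¹) * g` in `b` at `1`. This is the hypothesis `hmc` of
`lieBracket_leftInvariant_eq`, with the adjoint action as `c`. -/
theorem fderiv_chartMul_left_eq_right {x : E} (hx : x ∈ (χ).target) (v : E) :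
    fderiv ℝ (fun y => chartMul E G (x, y)) (χ 1) v =
      fderiv ℝ (fun y => chartMul E G (y, x)) (χ 1)
        (tangentAt E E (fun b : G => (χ).symm x * b * ((χ).symm x)⁻¹) 1 v) := by
  rw [fderiv_chartMul_left hx, fderiv_chartMul_right hx]
  have h := tangentAt_comp (mdifferentiableAt_mul_const ((χ).symm x) 1)
    (mdifferentiableAt_conj (E := E) ((χ).symm x) 1) (by simp)
  simp only [inv_mul_cancel_right] at h
  rw [h]
  rfl

/-- Pulling back along the inverse chart applies the inverse of its tangent map, which is the
tangent map of the chart. -/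
theorem mpullbackWithin_mulInvariantVectorField {x : E} (hx : x ∈ (χ).target) (v : E) :
    VectorField.mpullbackWithin 𝓘(ℝ, E) 𝓘(ℝ, E) (χ).symm
      (mulInvariantVectorField (G := G) (I := 𝓘(ℝ, E)) v) (Set.range 𝓘(ℝ, E)) x =
      fderiv ℝ (fun y => chartMul E G (x, y)) (χ 1) v := by
  rw [fderiv_chartMul_left hx, VectorField.mpullbackWithin_apply]
  have h := ContinuousLinearMap.inverse_eq (tangentAt_extChartAt_symm_comp hx)
    (tangentAt_extChartAt_comp_symm hx)
  rw [ModelWithCorners.range_eq_univ, mfderivWithin_univ]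
  exact congrArg (fun L : E →L[ℝ] E => L (tangentAt E E (fun b : G => (χ).symm x * b) 1 v)) h

theorem GroupLieAlgebra.lie_eq_tangentAt_conj (v w : GroupLieAlgebra 𝓘(ℝ, E) G) :
    ⁅v, w⁆ = tangentAt E (E →L[ℝ] E)
      (fun a : G => tangentAt E E (fun b : G => a * b * a⁻¹) 1) 1 v w := by
  -- The inverse chart has identity tangent map at the image of `1`, so the adjoint action has the
  -- same derivative on `G` and in the chart.
  have hc := tangentAt_comp (g := fun a : G => tangentAt E E (fun b : G => a * b * a⁻¹) 1)
    mdifferentiableAt_tangentAt_conj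
    (mdifferentiableAt_extChartAt_symm (mem_extChartAt_target (I := 𝓘(ℝ, E)) (1 : G)))
    (extChartAt_to_inv _)
  rw [tangentAt_extChartAt_symm, tangentAt_eq_fderiv, ContinuousLinearMap.comp_id] at hc
  have hd : DifferentiableAt ℝ
      (fun x => tangentAt E E (fun b : G => (χ).symm x * b * ((χ).symm x)⁻¹) 1) (χ 1) := by
    rw [← mdifferentiableAt_iff_differentiableAt]
    refine MDifferentiableAt.comp
      (g := fun a : G => tangentAt E E (fun b : G => a * b * a⁻¹) 1) _ ?_
      (mdifferentiableAt_extChartAt_symm (mem_extChartAt_target (I := 𝓘(ℝ, E)) (1 : G)))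
    rw [extChartAt_to_inv]
    exact mdifferentiableAt_tangentAt_conj
  have hb := lieBracket_leftInvariant_eq (m := chartMul E G)
    (contDiffAt_chartMul.of_le ENat.LEInfty.out) eventually_chartMul_right
    eventually_chartMul_left hd (by simp [tangentAt_id]) (by
      filter_upwards [extChartAt_target_mem_nhds (I := 𝓘(ℝ, E)) (1 : G)] with x hx v
      exact fderiv_chartMul_left_eq_right hx v) (v : E) (w : E)
  have hV : ∀ u : E, VectorField.mpullbackWithin 𝓘(ℝ, E) 𝓘(ℝ, E) (χ).symm
      (mulInvariantVectorField (G := G) (I := 𝓘(ℝ, E)) u) (Set.range 𝓘(ℝ, E)) =ᶠ[nhds (χ 1)]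
      fun x => fderiv ℝ (fun y => chartMul E G (x, y)) (χ 1) u := by
    intro u
    filter_upwards [extChartAt_target_mem_nhds (I := 𝓘(ℝ, E)) (1 : G)] with x hx
    exact mpullbackWithin_mulInvariantVectorField hx u
  rw [hc, ← (hV v).lieBracket_vectorField_eq (hV w)] at hb
  refine Eq.trans ?_ hb
  rw [GroupLieAlgebra.bracket_def, ← VectorField.mlieBracketWithin_univ,
    VectorField.mlieBracketWithin_apply]
  -- The manifold bracket is the bracket in the chart, pulled back by the chart; at `1` this last
  -- pullback is trivial.
  have hinv : (tangentAt E E χ (1 : G)).inverse = ContinuousLinearMap.id ℝ E := by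
    rw [tangentAt_extChartAt, ContinuousLinearMap.inverse_id]
  refine (congrArg (fun L : E →L[ℝ] E => L _) hinv).trans ?_
  rw [ModelWithCorners.range_eq_univ, Set.preimage_univ, Set.univ_inter]
  exact congrFun (VectorField.lieBracketWithin_univ (𝕜 := ℝ) (E := E)) _

end Adjoint

/-! ### Infinitesimal actions -/

/-! ### Leibniz, product and inverse rules for tangent maps -/

section TangentRules

variable {E F P : Type*} [NormedAddCommGroup E] [NormedSpace ℝ E]
  [NormedAddCommGroup F] [NormedSpace ℝ F] [NormedAddCommGroup P] [NormedSpace ℝ P]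
  {M : Type*} [TopologicalSpace M] [ChartedSpace E M]

theorem tangentAt_clm (L : F →L[ℝ] P) {f : M → F} {x : M}
    (hf : MDifferentiableAt 𝓘(ℝ, E) 𝓘(ℝ, F) f x) :
    tangentAt E P (fun z => L (f z)) x = L.comp (tangentAt E F f x) := by
  rw [tangentAt_comp L.mdifferentiableAt hf rfl, tangentAt_eq_fderiv, L.fderiv]

theorem tangentAt_clm_apply {A : M → F →L[ℝ] P} {u : M → F} {x : M}
    (hA : MDifferentiableAt 𝓘(ℝ, E) 𝓘(ℝ, F →L[ℝ] P) A x)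
    (hu : MDifferentiableAt 𝓘(ℝ, E) 𝓘(ℝ, F) u x) (v : E) :
    tangentAt E P (fun z => A z (u z)) x v =
      tangentAt E (F →L[ℝ] P) A x v (u x) + A x (tangentAt E F u x v) := by
  have hm : HasFDerivAt (fun z : (F →L[ℝ] P) × F => z.1 z.2) _ (A x, u x) :=
    hasFDerivAt_fst.clm_apply hasFDerivAt_snd
  -- The target carries the model of the normed space `(F →L[ℝ] P) × F`, not a product of two
  -- models, to match the derivative of evaluation in `hm`.
  have hp : HasMFDerivAt 𝓘(ℝ, E) 𝓘(ℝ, (F →L[ℝ] P) × F) (fun z => (A z, u z)) x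
      ((tangentAt E (F →L[ℝ] P) A x).prod (tangentAt E F u x)) :=
    ⟨hA.hasMFDerivAt.1.prodMk hu.hasMFDerivAt.1, hA.hasMFDerivAt.2.prodMk hu.hasMFDerivAt.2⟩
  have h := (HasMFDerivAt.comp (f := fun z => (A z, u z)) x hm.hasMFDerivAt hp).mfderiv
  refine (congrArg (fun L : E →L[ℝ] P => L v) h).trans ?_
  exact add_comm _ _

theorem tangentAt_sub {f g : M → F} {x : M} (hf : MDifferentiableAt 𝓘(ℝ, E) 𝓘(ℝ, F) f x)
    (hg : MDifferentiableAt 𝓘(ℝ, E) 𝓘(ℝ, F) g x) :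
    tangentAt E F (fun z => f z - g z) x = tangentAt E F f x - tangentAt E F g x :=
  mfderiv_sub hf hg

variable {G : Type*} [TopologicalSpace G] [ChartedSpace F G] [Group G] [LieGroup 𝓘(ℝ, F) ∞ G]

theorem tangentAt_mul {f g : M → G} {x : M} (hf : MDifferentiableAt 𝓘(ℝ, E) 𝓘(ℝ, F) f x)
    (hg : MDifferentiableAt 𝓘(ℝ, E) 𝓘(ℝ, F) g x) (hf1 : f x = 1) (hg1 : g x = 1) :
    tangentAt E F (fun z => f z * g z) x = tangentAt E F f x + tangentAt E F g x := by
  have hm : MDifferentiableAt (𝓘(ℝ, F).prod 𝓘(ℝ, F)) 𝓘(ℝ, F)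
      (fun z : G × G => z.1 * z.2) (1, 1) :=
    (contMDiff_mul 𝓘(ℝ, F) ∞).mdifferentiableAt (by simp)
  rw [tangentAt_apply₂ (m := fun z : G × G => z.1 * z.2) hm hf hg hf1 hg1]
  simp [tangentAt_id]

/-- Differentiate `(f z)⁻¹ * f z = 1` with the product rule. -/
theorem tangentAt_inv {f : M → G} {x : M} (hf : MDifferentiableAt 𝓘(ℝ, E) 𝓘(ℝ, F) f x)
    (hf1 : f x = 1) : tangentAt E F (fun z => (f z)⁻¹) x = -tangentAt E F f x := by
  have hi : MDifferentiableAt 𝓘(ℝ, E) 𝓘(ℝ, F) (fun z => (f z)⁻¹) x :=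
    MDifferentiableAt.comp (g := fun a : G => a⁻¹) x
      ((contMDiff_inv 𝓘(ℝ, F) ∞).mdifferentiableAt (by simp)) hf
  have h := tangentAt_mul hi hf (by rw [hf1, inv_one]) hf1
  simp only [inv_mul_cancel, tangentAt_const] at h
  exact eq_neg_of_add_eq_zero_left h.symm

end TangentRules

/-! ### Derivatives of smooth families of maps fixing the unit -/

section TangentAction

variable {EH EG : Type*} [NormedAddCommGroup EH] [NormedSpace ℝ EH]
  [NormedAddCommGroup EG] [NormedSpace ℝ EG]
  {H : Type*} [TopologicalSpace H] [ChartedSpace EH H] [Group H]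
  {G : Type*} [TopologicalSpace G] [ChartedSpace EG G] [Group G]

/-- A smooth family of smooth maps `α a : H → H` fixing `1`, indexed by `a : G`. -/
structure IsPointedFamily (EH EG : Type*) [NormedAddCommGroup EH] [NormedSpace ℝ EH]
    [NormedAddCommGroup EG] [NormedSpace ℝ EG] {H : Type*} [TopologicalSpace H] [ChartedSpace EH H]
    [Group H] {G : Type*} [TopologicalSpace G] [ChartedSpace EG G] (α : G → H → H) : Prop where
  smooth : ContMDiff (𝓘(ℝ, EG).prod 𝓘(ℝ, EH)) 𝓘(ℝ, EH) ∞ (fun z : G × H => α z.1 z.2)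
  map_one : ∀ a, α a 1 = 1

/-- The derivative at `1` of `a ↦ (α a)_*`. -/
noncomputable def tangentAction (EH EG : Type*) [NormedAddCommGroup EH] [NormedSpace ℝ EH]
    [NormedAddCommGroup EG] [NormedSpace ℝ EG] {H : Type*} [TopologicalSpace H] [ChartedSpace EH H]
    [Group H] {G : Type*} [TopologicalSpace G] [ChartedSpace EG G] [Group G] (α : G → H → H) :
    EG →L[ℝ] EH →L[ℝ] EH :=
  tangentAt EG (EH →L[ℝ] EH) (fun a => tangentAt EH EH (α a) 1) 1

namespace IsPointedFamily

variable {α : G → H → H}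

theorem mdifferentiableAt (hα : IsPointedFamily EH EG α) (a : G) (p : H) :
    MDifferentiableAt 𝓘(ℝ, EH) 𝓘(ℝ, EH) (α a) p :=
  MDifferentiableAt.comp (g := fun z : G × H => α z.1 z.2) (f := fun q : H => (a, q)) p
    (hα.smooth.mdifferentiableAt (by simp)) (mdifferentiableAt_const.prodMk mdifferentiableAt_id)

theorem mdifferentiableAt_tangentAt [LieGroup 𝓘(ℝ, EH) ∞ H] [LieGroup 𝓘(ℝ, EG) ∞ G]
    (hα : IsPointedFamily EH EG α) (a : G) :
    MDifferentiableAt 𝓘(ℝ, EG) 𝓘(ℝ, EH →L[ℝ] EH) (fun a => tangentAt EH EH (α a) 1) a :=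
  _root_.mdifferentiableAt_tangentAt hα.smooth.contMDiffAt hα.map_one

/-- Evaluation of the derivative of `a ↦ (α a)_*` along a map into the parameter group. -/
theorem tangentAt_comp_apply [LieGroup 𝓘(ℝ, EH) ∞ H] [LieGroup 𝓘(ℝ, EG) ∞ G]
    {E : Type*} [NormedAddCommGroup E] [NormedSpace ℝ E]
    {M : Type*} [TopologicalSpace M] [ChartedSpace E M]
    (hα : IsPointedFamily EH EG α) {f : M → G} {x : M}
    (hf : MDifferentiableAt 𝓘(ℝ, E) 𝓘(ℝ, EG) f x) (hf1 : f x = 1) (u : EH) (v : E) :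
    tangentAt E EH (fun b => tangentAt EH EH (α (f b)) 1 u) x v =
      tangentAction EH EG α (tangentAt E EG f x v) u := by
  have h2 := hα.mdifferentiableAt_tangentAt (f x)
  rw [tangentAt_clm_apply (A := fun b => tangentAt EH EH (α (f b)) 1) (u := fun _ => u)
    (h2.comp x hf) mdifferentiableAt_const,
    tangentAt_comp (hα.mdifferentiableAt_tangentAt 1) hf hf1, tangentAt_const]
  simp [tangentAction]

/-- Infinitesimal actions are natural in equivariant maps. -/
theorem tangentAction_map {EH' EG' : Type*} [NormedAddCommGroup EH'] [NormedSpace ℝ EH']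
    [NormedAddCommGroup EG'] [NormedSpace ℝ EG']
    {H' : Type*} [TopologicalSpace H'] [ChartedSpace EH' H'] [Group H']
    {G' : Type*} [TopologicalSpace G'] [ChartedSpace EG' G'] [Group G']
    [LieGroup 𝓘(ℝ, EH) ∞ H] [LieGroup 𝓘(ℝ, EG) ∞ G]
    [LieGroup 𝓘(ℝ, EH') ∞ H'] [LieGroup 𝓘(ℝ, EG') ∞ G']
    (hα : IsPointedFamily EH EG α) {β : G' → H' → H'} (hβ : IsPointedFamily EH' EG' β)
    {f : G → G'} {h : H → H'} (hf : MDifferentiableAt 𝓘(ℝ, EG) 𝓘(ℝ, EG') f 1)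
    (hh : MDifferentiableAt 𝓘(ℝ, EH) 𝓘(ℝ, EH') h 1) (hf1 : f 1 = 1) (hh1 : h 1 = 1)
    (hαβ : ∀ a p, h (α a p) = β (f a) (h p)) (x : EG) (u : EH) :
    tangentAt EH EH' h 1 (tangentAction EH EG α x u) =
      tangentAction EH' EG' β (tangentAt EG EG' f 1 x) (tangentAt EH EH' h 1 u) := by
  -- Differentiate the equivariance in `p` at `1` for fixed `a`; the rest of the proof
  -- differentiates the result in `a`.
  have h1 : ∀ a, tangentAt EH EH' h 1 (tangentAt EH EH (α a) 1 u) =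
      tangentAt EH' EH' (β (f a)) 1 (tangentAt EH EH' h 1 u) := by
    intro a
    have e1 := tangentAt_comp hh (hα.mdifferentiableAt a 1) (hα.map_one a)
    have e2 := tangentAt_comp (hβ.mdifferentiableAt (f a) 1) hh hh1
    simp only [hαβ] at e1
    exact congrArg (fun L : EH →L[ℝ] EH' => L u) (e1.symm.trans e2)
  rw [← hβ.tangentAt_comp_apply hf hf1, ← funext h1]
  have h2 : MDifferentiableAt 𝓘(ℝ, EG) 𝓘(ℝ, EH) (fun a => tangentAt EH EH (α a) 1 u) 1 :=
    (hα.mdifferentiableAt_tangentAt 1).clm_apply mdifferentiableAt_const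
  rw [tangentAt_clm _ h2]
  have h3 := hα.tangentAt_comp_apply (f := fun a : G => a) (x := 1) mdifferentiableAt_id rfl u x
  rw [tangentAt_id] at h3
  rw [ContinuousLinearMap.comp_apply, h3]
  rfl

end IsPointedFamily

theorem isPointedFamily_conj [LieGroup 𝓘(ℝ, EG) ∞ G] :
    IsPointedFamily EG EG (fun a b : G => a * b * a⁻¹) where
  smooth := contMDiff_conj
  map_one := by simp

/-- Puts brackets in the same form as infinitesimal actions, so that naturality applies to both. -/
theorem GroupLieAlgebra.lie_eq_tangentAction [LieGroup 𝓘(ℝ, EG) ∞ G]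
    (v w : GroupLieAlgebra 𝓘(ℝ, EG) G) :
    ⁅v, w⁆ = tangentAction EG EG (fun a b : G => a * b * a⁻¹) v w :=
  GroupLieAlgebra.lie_eq_tangentAt_conj v w

/-- The tangent map at `1`, as a linear map between Lie algebras. -/
noncomputable def tangentOne (EH EG : Type*) [NormedAddCommGroup EH] [NormedSpace ℝ EH]
    [NormedAddCommGroup EG] [NormedSpace ℝ EG]
    {H : Type*} [TopologicalSpace H] [ChartedSpace EH H] [Group H]
    {G : Type*} [TopologicalSpace G] [ChartedSpace EG G] [Group G] (f : H → G) :
    GroupLieAlgebra 𝓘(ℝ, EH) H →ₗ[ℝ] GroupLieAlgebra 𝓘(ℝ, EG) G :=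
  (tangentAt EH EG f 1 : EH →ₗ[ℝ] EG)

/-- The tangent map at `1` of a smooth homomorphism preserves brackets. -/
theorem tangentOne_lie [LieGroup 𝓘(ℝ, EH) ∞ H] [LieGroup 𝓘(ℝ, EG) ∞ G] {f : H → G}
    (hf : ContMDiff 𝓘(ℝ, EH) 𝓘(ℝ, EG) ∞ f) (hmul : ∀ p q, f (p * q) = f p * f q)
    (u v : GroupLieAlgebra 𝓘(ℝ, EH) H) :
    tangentOne EH EG f ⁅u, v⁆ = ⁅tangentOne EH EG f u, tangentOne EH EG f v⁆ := by
  have hd : MDifferentiableAt 𝓘(ℝ, EH) 𝓘(ℝ, EG) f 1 := hf.mdifferentiableAt (by simp)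
  have h1 : f 1 = 1 := (MonoidHom.mk' f hmul).map_one
  rw [GroupLieAlgebra.lie_eq_tangentAction, GroupLieAlgebra.lie_eq_tangentAction]
  refine isPointedFamily_conj.tangentAction_map isPointedFamily_conj hd hd h1 h1 (fun a p => ?_) u v
  rw [hmul, hmul]
  exact congrArg (f a * f p * ·) ((MonoidHom.mk' f hmul).map_inv a)

end TangentAction

/-! ### The crossed module of Lie algebras of a crossed module of Lie groups -/

namespace IsPointedFamily

variable {EH EG : Type*} [NormedAddCommGroup EH] [NormedSpace ℝ EH]
  [NormedAddCommGroup EG] [NormedSpace ℝ EG]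
  {H : Type*} [TopologicalSpace H] [ChartedSpace EH H] [Group H] [LieGroup 𝓘(ℝ, EH) ∞ H]
  {G : Type*} [TopologicalSpace G] [ChartedSpace EG G] [Group G] [LieGroup 𝓘(ℝ, EG) ∞ G]
  {α : G → H → H}

/-- Evaluation at `u` is continuous and linear, so it commutes with differentiation in `a`. This
links the pointwise definition of `tangentAct` to the operator-valued `tangentAction`. -/
theorem tangentAt_apply (hα : IsPointedFamily EH EG α) (x : EG) (u : EH) :
    tangentAt EG EH (fun a => tangentAt EH EH (α a) 1 u) 1 x = tangentAction EH EG α x u := by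
  rw [hα.tangentAt_comp_apply (f := fun a : G => a) mdifferentiableAt_id rfl u x, tangentAt_id]
  rfl

theorem mdifferentiableAt_tangentAt_apply (hα : IsPointedFamily EH EG α) (u : EH) :
    MDifferentiableAt 𝓘(ℝ, EG) 𝓘(ℝ, EH) (fun a => tangentAt EH EH (α a) 1 u) 1 :=
  (hα.mdifferentiableAt_tangentAt 1).clm_apply mdifferentiableAt_const

end IsPointedFamily

namespace GroupCrossedModule

variable {EH EG : Type*} [NormedAddCommGroup EH] [NormedSpace ℝ EH]
  [NormedAddCommGroup EG] [NormedSpace ℝ EG]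
  {H : Type*} [TopologicalSpace H] [ChartedSpace EH H] [Group H]
  {G : Type*} [TopologicalSpace G] [ChartedSpace EG G] [Group G]
  (X : GroupCrossedModule EH EG H G)

theorem isPointedFamily_act : IsPointedFamily EH EG (fun (a : G) (p : H) => X.act a p) where
  smooth := X.smooth_act
  map_one a := map_one (X.act a)

theorem tangentAt_act_one :
    tangentAt EH EH (fun p : H => X.act 1 p) 1 = ContinuousLinearMap.id ℝ EH := by
  simp [tangentAt_id]

variable [LieGroup 𝓘(ℝ, EH) ∞ H] [LieGroup 𝓘(ℝ, EG) ∞ G]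

/-- The infinitesimal action `φ` as a bilinear map. -/
noncomputable def infinitesimalAct : GroupLieAlgebra 𝓘(ℝ, EG) G →ₗ[ℝ]
    GroupLieAlgebra 𝓘(ℝ, EH) H →ₗ[ℝ] GroupLieAlgebra 𝓘(ℝ, EH) H :=
  LinearMap.mk₂ ℝ (fun (x : EG) (u : EH) =>
      (tangentAction EH EG (fun (a : G) (p : H) => X.act a p) x u : EH))
    (fun x y u => congrArg (fun L : EH →L[ℝ] EH => L u) (map_add _ x y))
    (fun c x u => congrArg (fun L : EH →L[ℝ] EH => L u) (map_smul _ c x))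
    (fun _ u v => map_add _ u v)
    (fun c _ u => map_smul _ c u)

theorem tangentAct_eq (x : GroupLieAlgebra 𝓘(ℝ, EG) G) (u : GroupLieAlgebra 𝓘(ℝ, EH) H) :
    X.tangentAct x u = X.infinitesimalAct x u :=
  X.isPointedFamily_act.tangentAt_apply x u

/-- The automorphism `Φ(a)` has a bracket-preserving tangent map at `1`. Differentiating this at `a
= 1`, where that tangent map is the identity, gives the derivation rule for `φ x`. -/
theorem tangentAction_conj_apply (x : EG) (u v : EH) :
    tangentAction EH EG (fun (a : G) (p : H) => X.act a p) x
        (tangentAction EH EH (fun p q : H => p * q * p⁻¹) u v) =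
      tangentAction EH EH (fun p q : H => p * q * p⁻¹)
          (tangentAction EH EG (fun (a : G) (p : H) => X.act a p) x u) v +
        tangentAction EH EH (fun p q : H => p * q * p⁻¹) u
          (tangentAction EH EG (fun (a : G) (p : H) => X.act a p) x v) := by
  have hα := X.isPointedFamily_act
  set b := tangentAction EH EH (fun p q : H => p * q * p⁻¹)
  have h1 : ∀ a : G, tangentAt EH EH (fun p : H => X.act a p) 1 (b u v) =
      b (tangentAt EH EH (fun p : H => X.act a p) 1 u)
        (tangentAt EH EH (fun p : H => X.act a p) 1 v) := by
    intro a
    have hd := hα.mdifferentiableAt a 1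
    refine isPointedFamily_conj.tangentAction_map isPointedFamily_conj hd hd (hα.map_one a)
      (hα.map_one a) (fun p q => by simp) u v
  have h2 := hα.tangentAt_apply x (b u v)
  rw [funext h1, tangentAt_clm_apply
    (A := fun a : G => b (tangentAt EH EH (fun p : H => X.act a p) 1 u))
    (u := fun a : G => tangentAt EH EH (fun p : H => X.act a p) 1 v)
    (b.mdifferentiableAt.comp 1 (hα.mdifferentiableAt_tangentAt_apply u))
    (hα.mdifferentiableAt_tangentAt_apply v), tangentAt_clm b (hα.mdifferentiableAt_tangentAt_apply u),
    ContinuousLinearMap.comp_apply, hα.tangentAt_apply, hα.tangentAt_apply, tangentAt_act_one] at h2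
  exact h2.symm

/-- From `Φ(a) Φ(b) = Φ(a b a⁻¹) Φ(a)`, naturality shows that the tangent map of `Φ(a)` takes `φ(y)
u` to `φ(Ad_a y)` applied to the image of `u`. The derivative at `a = 1` is the compatibility of `φ`
with brackets. -/
theorem tangentAction_conj_add (x y : EG) (u : EH) :
    tangentAction EH EG (fun (a : G) (p : H) => X.act a p)
        (tangentAction EG EG (fun a b : G => a * b * a⁻¹) x y) u +
      tangentAction EH EG (fun (a : G) (p : H) => X.act a p) y
        (tangentAction EH EG (fun (a : G) (p : H) => X.act a p) x u) =
      tangentAction EH EG (fun (a : G) (p : H) => X.act a p) x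
        (tangentAction EH EG (fun (a : G) (p : H) => X.act a p) y u) := by
  have hα := X.isPointedFamily_act
  have hc : IsPointedFamily EG EG (fun a b : G => a * b * a⁻¹) := isPointedFamily_conj
  set D := tangentAction EH EG (fun (a : G) (p : H) => X.act a p)
  have h1 : ∀ a : G, tangentAt EH EH (fun p : H => X.act a p) 1 (D y u) =
      D (tangentAt EG EG (fun b : G => a * b * a⁻¹) 1 y)
        (tangentAt EH EH (fun p : H => X.act a p) 1 u) := fun a =>
    hα.tangentAction_map hα (hc.mdifferentiableAt a 1) (hα.mdifferentiableAt a 1) (hc.map_one a)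
      (hα.map_one a) (fun b p => by simp) y u
  have h2 := hα.tangentAt_apply x (D y u)
  rw [funext h1, tangentAt_clm_apply
    (A := fun a : G => D (tangentAt EG EG (fun b : G => a * b * a⁻¹) 1 y))
    (u := fun a : G => tangentAt EH EH (fun p : H => X.act a p) 1 u)
    (D.mdifferentiableAt.comp 1 (hc.mdifferentiableAt_tangentAt_apply y))
    (hα.mdifferentiableAt_tangentAt_apply u), tangentAt_clm D (hc.mdifferentiableAt_tangentAt_apply y),
    ContinuousLinearMap.comp_apply, hc.tangentAt_apply, hα.tangentAt_apply, tangentAt_act_one] at h2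
  simp only [one_mul, inv_one, mul_one, tangentAt_id] at h2
  exact h2

theorem infinitesimalAct_lie [CompleteSpace EH] (x : GroupLieAlgebra 𝓘(ℝ, EG) G)
    (u v : GroupLieAlgebra 𝓘(ℝ, EH) H) :
    X.infinitesimalAct x ⁅u, v⁆ = ⁅u, X.infinitesimalAct x v⁆ - ⁅v, X.infinitesimalAct x u⁆ := by
  rw [← lie_skew v, sub_neg_eq_add, add_comm]
  simp only [GroupLieAlgebra.lie_eq_tangentAction]
  exact X.tangentAction_conj_apply x u v

theorem lie_infinitesimalAct (x y : GroupLieAlgebra 𝓘(ℝ, EG) G)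
    (u : GroupLieAlgebra 𝓘(ℝ, EH) H) :
    X.infinitesimalAct ⁅x, y⁆ u = X.infinitesimalAct x (X.infinitesimalAct y u) -
      X.infinitesimalAct y (X.infinitesimalAct x u) := by
  rw [GroupLieAlgebra.lie_eq_tangentAction, eq_sub_iff_add_eq]
  exact X.tangentAction_conj_add x y u

/-- By `t_act`, `t` is equivariant over the identity of `G`, from `Φ` to conjugation. -/
theorem tangentOne_infinitesimalAct (x : GroupLieAlgebra 𝓘(ℝ, EG) G)
    (u : GroupLieAlgebra 𝓘(ℝ, EH) H) :
    tangentOne EH EG X.t (X.infinitesimalAct x u) = ⁅x, tangentOne EH EG X.t u⁆ := by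
  rw [GroupLieAlgebra.lie_eq_tangentAction]
  refine (X.isPointedFamily_act.tangentAction_map isPointedFamily_conj (f := fun a : G => a)
    mdifferentiableAt_id (X.smooth_t.mdifferentiableAt (by simp)) rfl (map_one X.t)
    X.t_act x u).trans ?_
  rw [tangentAt_id]
  rfl

/-- By `act_t`, the identity of `H` is equivariant over `t`, from conjugation to `Φ`. -/
theorem infinitesimalAct_tangentOne (u v : GroupLieAlgebra 𝓘(ℝ, EH) H) :
    X.infinitesimalAct (tangentOne EH EG X.t u) v = ⁅u, v⁆ := by
  rw [GroupLieAlgebra.lie_eq_tangentAction]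
  have h := isPointedFamily_conj.tangentAction_map X.isPointedFamily_act (h := fun p : H => p)
    (X.smooth_t.mdifferentiableAt (by simp)) mdifferentiableAt_id (map_one X.t) rfl
    (fun p q => (X.act_t p q).symm) u v
  rw [tangentAt_id] at h
  exact h.symm

variable [CompleteSpace EH] [CompleteSpace EG]

/-- The crossed module of Lie algebras of a crossed module of Lie groups. -/
noncomputable def lieCrossedModule :
    LieCrossedModule ℝ (GroupLieAlgebra 𝓘(ℝ, EH) H) (GroupLieAlgebra 𝓘(ℝ, EG) G) where
  dt :=
    { tangentOne EH EG X.t with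
      map_lie' := fun {u v} => tangentOne_lie X.smooth_t X.t.map_mul u v }
  φ :=
    { toFun := fun x =>
        { X.infinitesimalAct x with
          leibniz' := X.infinitesimalAct_lie x }
      map_add' := fun x y => LieDerivation.ext fun u => by
        exact congrArg (fun L => L u) (map_add X.infinitesimalAct x y)
      map_smul' := fun c x => LieDerivation.ext fun u => by
        exact congrArg (fun L => L u) (map_smul X.infinitesimalAct c x)
      map_lie' := fun {x y} => LieDerivation.ext fun u => by
        rw [LieDerivation.lie_apply]
        exact X.lie_infinitesimalAct x y u }
  dt_φ := X.tangentOne_infinitesimalAct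
  φ_dt := X.infinitesimalAct_tangentOne

theorem isCrossedModuleOf_lieCrossedModule :
    X.lieCrossedModule.IsCrossedModuleOf X LieEquiv.refl LieEquiv.refl where
  dt_eq _ := rfl
  φ_eq x u := (X.tangentAct_eq x u).symm

end GroupCrossedModule

/-! ### Differentiation of Rota-Baxter operators -/

namespace GroupCrossedModule

/-- The crossed module `(G, G, id, Ad)`. -/
def conj (E G : Type*) [NormedAddCommGroup E] [NormedSpace ℝ E] [TopologicalSpace G]
    [ChartedSpace E G] [Group G] [LieGroup 𝓘(ℝ, E) ∞ G] : GroupCrossedModule E E G G where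
  t := MonoidHom.id G
  smooth_t := contMDiff_id
  act := MulAut.conj
  smooth_act := contMDiff_conj
  act_t _ _ := rfl
  t_act _ _ := rfl

/-- A Rota-Baxter operator on `G` as an operator on the crossed module `(G, G, id, Ad)`. -/
def conjRotaBaxter {E G : Type*} [NormedAddCommGroup E] [NormedSpace ℝ E] [TopologicalSpace G]
    [ChartedSpace E G] [Group G] [LieGroup 𝓘(ℝ, E) ∞ G] (B : GroupRotaBaxter E G) :
    (conj E G).RotaBaxter where
  B₁ := B
  B₀ := B
  t_comm _ := rfl
  act_comm a p := by
    have h1 : B a * B p = B (B.descMul a p) := (B.map_descMul a p).symm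
    have h2 : B (B.descInv a) = (B a)⁻¹ := by
      have h := B.map_descMul (B.descInv a) a
      rw [B.descInv_descMul, B.map_one] at h
      exact (inv_eq_of_mul_eq_one_left h.symm).symm
    -- For the adjoint action, `Φ̂(a)` is conjugation by `a` in `(G, ·_B)`, and `B` is a
    -- homomorphism out of that group.
    have h3 : (conj E G).act (a * B a) (p * B p) * (conj E G).act (B a) (B p)⁻¹ =
        B.descMul (B.descMul a p) (B.descInv a) := by
      rw [GroupRotaBaxter.descMul, B.map_descMul]
      simp only [conj, MulAut.conj_apply, GroupRotaBaxter.descMul, GroupRotaBaxter.descInv]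
      group
    rw [h3, B.map_descMul, ← h1, h2]
    rfl

namespace RotaBaxter

variable {EH EG : Type*} [NormedAddCommGroup EH] [NormedSpace ℝ EH]
  [NormedAddCommGroup EG] [NormedSpace ℝ EG]
  {H : Type*} [TopologicalSpace H] [ChartedSpace EH H] [Group H] [LieGroup 𝓘(ℝ, EH) ∞ H]
  {G : Type*} [TopologicalSpace G] [ChartedSpace EG G] [Group G] [LieGroup 𝓘(ℝ, EG) ∞ G]
  {X : GroupCrossedModule EH EG H G} (B : X.RotaBaxter)

/-- Both factors of `Φ̂(a) p` equal `1` at `p = 1`, so their tangent maps add, and the inverse in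
the second gives the sign. -/
theorem tangentAt_descAct (a : G) (u : EH) :
    tangentAt EH EH (fun p : H => B.descAct a p) 1 u =
      tangentAt EH EH (fun p : H => X.act (a * B.B₀ a) p) 1 (u + tangentAt EH EH B.B₁ 1 u) -
        tangentAt EH EH (fun p : H => X.act (B.B₀ a) p) 1 (tangentAt EH EH B.B₁ 1 u) := by
  have hX := X.isPointedFamily_act
  have hB : MDifferentiableAt 𝓘(ℝ, EH) 𝓘(ℝ, EH) B.B₁ 1 :=
    B.B₁.smooth.mdifferentiableAt (by simp)
  have hi : MDifferentiableAt 𝓘(ℝ, EH) 𝓘(ℝ, EH) (fun p : H => (B.B₁ p)⁻¹) 1 :=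
    B.B₁.smooth.inv.mdifferentiableAt (by simp)
  have hm : MDifferentiableAt 𝓘(ℝ, EH) 𝓘(ℝ, EH) (fun p : H => p * B.B₁ p) 1 :=
    (contMDiff_id.mul B.B₁.smooth).mdifferentiableAt (by simp)
  have e1 : (1 : H) * B.B₁ 1 = 1 := by rw [B.B₁.map_one, one_mul]
  have e2 : (B.B₁ 1)⁻¹ = 1 := by rw [B.B₁.map_one, inv_one]
  have hd := fun b => hX.mdifferentiableAt b 1
  have hd1 : MDifferentiableAt 𝓘(ℝ, EH) 𝓘(ℝ, EH)
      (fun p : H => X.act (a * B.B₀ a) (p * B.B₁ p)) 1 :=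
    MDifferentiableAt.comp (g := fun p : H => X.act (a * B.B₀ a) p) 1
      (hX.mdifferentiableAt _ _) hm
  have hd2 : MDifferentiableAt 𝓘(ℝ, EH) 𝓘(ℝ, EH)
      (fun p : H => X.act (B.B₀ a) (B.B₁ p)⁻¹) 1 :=
    MDifferentiableAt.comp (g := fun p : H => X.act (B.B₀ a) p) 1
      (hX.mdifferentiableAt _ _) hi
  have h := tangentAt_mul hd1 hd2 (by rw [e1, map_one]) (by rw [e2, map_one])
  rw [tangentAt_comp (hd (a * B.B₀ a)) hm e1, tangentAt_comp (hd (B.B₀ a)) hi e2,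
    tangentAt_inv hB B.B₁.map_one, tangentAt_mul (f := fun p : H => p) mdifferentiableAt_id hB rfl B.B₁.map_one,
    tangentAt_id] at h
  refine (congrArg (fun L : EH →L[ℝ] EH => L u) h).trans ?_
  simp [sub_eq_add_neg]

theorem isPointedFamily_descAct :
    IsPointedFamily EH EG (fun (a : G) (p : H) => B.descAct a p) where
  smooth := B.desc.smooth_act
  map_one a := by simp [descAct, GroupRotaBaxter.map_one]

/-- Differentiating in `a` gives `φ(x + B₀ x)(u + B₁ u) - φ(B₀ x)(B₁ u)`; expanding cancels the term
`φ(B₀ x)(B₁ u)`. -/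
theorem tangentAction_descAct (x : EG) (u : EH) :
    tangentAction EH EG (fun (a : G) (p : H) => B.descAct a p) x u =
      tangentAction EH EG (fun (a : G) (p : H) => X.act a p) x (tangentAt EH EH B.B₁ 1 u) +
        tangentAction EH EG (fun (a : G) (p : H) => X.act a p) (tangentAt EG EG B.B₀ 1 x) u +
        tangentAction EH EG (fun (a : G) (p : H) => X.act a p) x u := by
  have hX := X.isPointedFamily_act
  have hB : MDifferentiableAt 𝓘(ℝ, EG) 𝓘(ℝ, EG) B.B₀ 1 :=
    B.B₀.smooth.mdifferentiableAt (by simp)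
  have hm : MDifferentiableAt 𝓘(ℝ, EG) 𝓘(ℝ, EG) (fun a : G => a * B.B₀ a) 1 :=
    (contMDiff_id.mul B.B₀.smooth).mdifferentiableAt (by simp)
  have e1 : (1 : G) * B.B₀ 1 = 1 := by rw [B.B₀.map_one, one_mul]
  have hf : ∀ {f : G → G} (w : EH), MDifferentiableAt 𝓘(ℝ, EG) 𝓘(ℝ, EG) f 1 →
      MDifferentiableAt 𝓘(ℝ, EG) 𝓘(ℝ, EH)
        (fun a => tangentAt EH EH (fun p : H => X.act (f a) p) 1 w) 1 := fun {f} w hf =>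
    MDifferentiableAt.clm_apply (g := fun a => tangentAt EH EH (fun p : H => X.act (f a) p) 1)
      ((hX.mdifferentiableAt_tangentAt (f 1)).comp 1 hf) mdifferentiableAt_const
  rw [← B.isPointedFamily_descAct.tangentAt_apply x u, funext fun a => B.tangentAt_descAct a u]
  rw [tangentAt_sub (hf (u + tangentAt EH EH B.B₁ 1 u) hm) (hf (tangentAt EH EH B.B₁ 1 u) hB),
    sub_apply]
  have h1 := hX.tangentAt_comp_apply hm e1 (u + tangentAt EH EH B.B₁ 1 u) x
  have h2 := hX.tangentAt_comp_apply hB B.B₀.map_one (tangentAt EH EH B.B₁ 1 u) x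
  rw [tangentAt_mul (f := fun a : G => a) mdifferentiableAt_id hB rfl B.B₀.map_one, tangentAt_id] at h1
  refine (congrArg₂ (· - ·) h1 h2).trans ?_
  simp only [add_apply, map_add, ContinuousLinearMap.id_apply]
  abel

end RotaBaxter

end GroupCrossedModule

/-! ### Rota-Baxter operators on a single Lie group -/

namespace GroupRotaBaxter

variable {E : Type*} [NormedAddCommGroup E] [NormedSpace ℝ E]
  {G : Type*} [TopologicalSpace G] [ChartedSpace E G] [Group G] [LieGroup 𝓘(ℝ, E) ∞ G]
  (B : GroupRotaBaxter E G)

/-- The bracket of the descendent Lie group. -/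
theorem lie_desc (x y : GroupLieAlgebra 𝓘(ℝ, E) G) :
    (Bracket.bracket (L := GroupLieAlgebra 𝓘(ℝ, E) B.Desc) (M := GroupLieAlgebra 𝓘(ℝ, E) B.Desc)
      x y : GroupLieAlgebra 𝓘(ℝ, E) B.Desc) =
      ⁅tangentOne E E B x, y⁆ + ⁅x, tangentOne E E B y⁆ + ⁅x, y⁆ := by
  -- In the descendent of `(G, G, id, Ad)` the map `t` is the identity, so its axiom `act_t` says
  -- that `Φ̂` is conjugation for `·_B`.
  have h1 : (fun a b : B.Desc => a * b * a⁻¹) =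
      fun a b => (GroupCrossedModule.conjRotaBaxter B).descAct a b :=
    funext fun a => funext fun b =>
      ((GroupCrossedModule.conjRotaBaxter B).desc.act_t a b).symm
  have h2 : ∀ v w : GroupLieAlgebra 𝓘(ℝ, E) B.Desc, ⁅v, w⁆ =
      tangentAction E E (fun a b : B.Desc => a * b * a⁻¹) v w :=
    GroupLieAlgebra.lie_eq_tangentAction
  refine (h2 x y).trans ?_
  rw [h1, add_comm ⁅tangentOne E E B x, y⁆]
  simp only [GroupLieAlgebra.lie_eq_tangentAction]
  exact (GroupCrossedModule.conjRotaBaxter B).tangentAction_descAct x y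

variable [CompleteSpace E]

/-- The Rota-Baxter operator on the Lie algebra of `G`. -/
noncomputable def lieRotaBaxter : LieRotaBaxter ℝ (GroupLieAlgebra 𝓘(ℝ, E) G) where
  toLin := tangentOne E E B
  lie_eq x y := by
    -- Seen on `B.Desc`, `B` is a smooth homomorphism to `G`, so its tangent map preserves brackets;
    -- by `lie_desc` this is the Rota-Baxter identity.
    have hs : ContMDiff 𝓘(ℝ, E) 𝓘(ℝ, E) ∞ (fun a : B.Desc => B a) := B.smooth
    rw [← B.lie_desc x y]
    exact (tangentOne_lie hs B.map_descMul x y).symm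

/-- The identity map from the descendent Lie algebra to the Lie algebra of the descendent
Lie group. -/
noncomputable def descLieEquiv :
    B.lieRotaBaxter.Desc ≃ₗ⁅ℝ⁆ GroupLieAlgebra 𝓘(ℝ, E) B.Desc where
  toFun x := x
  invFun x := x
  left_inv _ := rfl
  right_inv _ := rfl
  map_add' _ _ := rfl
  map_smul' _ _ := rfl
  map_lie' {x y} := (B.lie_desc x y).symm

end GroupRotaBaxter

/-! ### Rota-Baxter operators on crossed modules -/

namespace GroupCrossedModule.RotaBaxter

variable {EH EG : Type*} [NormedAddCommGroup EH] [NormedSpace ℝ EH] [CompleteSpace EH]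
  [NormedAddCommGroup EG] [NormedSpace ℝ EG] [CompleteSpace EG]
  {H : Type*} [TopologicalSpace H] [ChartedSpace EH H] [Group H] [LieGroup 𝓘(ℝ, EH) ∞ H]
  {G : Type*} [TopologicalSpace G] [ChartedSpace EG G] [Group G] [LieGroup 𝓘(ℝ, EG) ∞ G]
  {X : GroupCrossedModule EH EG H G} (B : X.RotaBaxter)

/-- The Rota-Baxter operator on the crossed module of Lie algebras. -/
noncomputable def lieRotaBaxter : X.lieCrossedModule.RotaBaxter where
  B₁ := B.B₁.lieRotaBaxter
  B₀ := B.B₀.lieRotaBaxter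
  dt_comm u := by
    have hB₁ : MDifferentiableAt 𝓘(ℝ, EH) 𝓘(ℝ, EH) B.B₁ 1 :=
      B.B₁.smooth.mdifferentiableAt (by simp)
    have hB₀ : MDifferentiableAt 𝓘(ℝ, EG) 𝓘(ℝ, EG) B.B₀ 1 :=
      B.B₀.smooth.mdifferentiableAt (by simp)
    have ht : MDifferentiableAt 𝓘(ℝ, EH) 𝓘(ℝ, EG) X.t 1 :=
      X.smooth_t.mdifferentiableAt (by simp)
    have h1 := tangentAt_comp ht hB₁ B.B₁.map_one
    have h2 := tangentAt_comp hB₀ ht (map_one X.t)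
    simp only [B.t_comm] at h1
    exact congrArg (fun L : EH →L[ℝ] EG => L u) (h1.symm.trans h2)
  φ_comm x u := by
    -- The Rota-Baxter condition says that `B₁` is equivariant over `B₀`, from `Φ̂` to `Φ`.
    have h := B.isPointedFamily_descAct.tangentAction_map X.isPointedFamily_act
      (B.B₀.smooth.mdifferentiableAt (by simp)) (B.B₁.smooth.mdifferentiableAt (by simp))
      B.B₀.map_one B.B₁.map_one B.map_descAct x u
    rw [B.tangentAction_descAct x u] at h
    exact h.symm

/-- Manifolds, tangent spaces and the underlying map `t` are unchanged, so only the actions need an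
argument. -/
theorem isCrossedModuleOf_desc :
    B.lieRotaBaxter.desc.IsCrossedModuleOf B.desc B.B₁.descLieEquiv B.B₀.descLieEquiv where
  dt_eq _ := rfl
  φ_eq x u := by
    rw [tangentAct_eq]
    exact (B.tangentAction_descAct x u).symm

end GroupCrossedModule.RotaBaxter

theorem propositiond2
    {EH EG : Type*} [NormedAddCommGroup EH] [NormedSpace ℝ EH] [CompleteSpace EH]
    [NormedAddCommGroup EG] [NormedSpace ℝ EG] [CompleteSpace EG]
    {H : Type*} [TopologicalSpace H] [ChartedSpace EH H] [Group H] [LieGroup 𝓘(ℝ, EH) ∞ H]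
    {G : Type*} [TopologicalSpace G] [ChartedSpace EG G] [Group G] [LieGroup 𝓘(ℝ, EG) ∞ G]
    (X : GroupCrossedModule EH EG H G) (𝓑 : X.RotaBaxter) :
    -- the crossed module of Lie algebras `(𝔥, 𝔤, dt, φ)` of `X`
    ∃ Y : LieCrossedModule ℝ (GroupLieAlgebra 𝓘(ℝ, EH) H) (GroupLieAlgebra 𝓘(ℝ, EG) G),
      Y.IsCrossedModuleOf X LieEquiv.refl LieEquiv.refl ∧
    -- the tangent maps of the group operators form a Rota-Baxter operator on it
    ∃ B : Y.RotaBaxter,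
      (∀ u, B.B₁ u = mfderiv 𝓘(ℝ, EH) 𝓘(ℝ, EH) 𝓑.B₁ (1 : H) u) ∧
      (∀ x, B.B₀ x = mfderiv 𝓘(ℝ, EG) 𝓘(ℝ, EG) 𝓑.B₀ (1 : G) x) ∧
    -- the identity maps identify the descendent Lie algebras with the Lie algebras of the
    -- descendent Lie groups, and the descendent crossed modules correspond
    ∃ (eh : B.B₁.Desc ≃ₗ⁅ℝ⁆ GroupLieAlgebra 𝓘(ℝ, EH) 𝓑.B₁.Desc)
      (eg : B.B₀.Desc ≃ₗ⁅ℝ⁆ GroupLieAlgebra 𝓘(ℝ, EG) 𝓑.B₀.Desc),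
      (∀ u : GroupLieAlgebra 𝓘(ℝ, EH) H, eh u = u) ∧
      (∀ x : GroupLieAlgebra 𝓘(ℝ, EG) G, eg x = x) ∧
      B.desc.IsCrossedModuleOf 𝓑.desc eh eg :=
  ⟨X.lieCrossedModule, X.isCrossedModuleOf_lieCrossedModule, 𝓑.lieRotaBaxter, fun _ => rfl,
    fun _ => rfl, 𝓑.B₁.descLieEquiv, 𝓑.B₀.descLieEquiv, fun _ => rfl, fun _ => rfl,
    𝓑.isCrossedModuleOf_desc⟩
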